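/- Let $d\ge 2$ and let $\Lambda$ be a stationary random Borel measure on $\mathbb R^d$ (measurable with respect to the evaluation $\sigma$-algebra) with $\mathbb E[\Lambda([0,1]^d)]=1$. For $\lambda>0$ let $X^\lambda$ be a Cox process with intensity measure $\lambda\Lambda$, i.e. conditioned on $\Lambda$ it is a Poisson point process with intensity measure $\lambda\Lambda$. For $r>0$ let $g_r(X^\lambda)$ be the Gilbert graph, in which two points of $X^\lambda$ are joined by an edge if their Euclidean distance is less than $r$; it percolates if it has an infinite connected component. Put $\lambda_c(r)=\inf\{\lambda>0:\ \mathbb P(g_r(X^\lambda)\text{ percolates})>0\}\in[0,\infty]$, with $\inf\emptyset=\infty$. Write $Q_s(x)=x+[-s/2,s/2]^d$, $Q_s=Q_s(o)$, and let $\Lambda_B$ be the restriction of $\Lambda$ to $B$. The random measure $\Lambda$ is stabilizing, with stabilization radii $R=\{R_x\}_{x\in\mathbb R^d}$, if $R$ is a random field with values in $[0,\infty]$ on the probability space of $\Lambda$ such that 1. $(\Lambda,R)$ is jointly stationary; 2. $\lim_{n\to\infty}\mathbb P\big(\sup_{y\in Q_n\cap\mathbb Q^d}R_y<n\big)=1$;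 3. for all integers $n\ge1$, all bounded measurable functions $f\ge 0$ on the space of Borel measures and all finite $\varphi\subset\mathbb R^d$ whose points have pairwise distances greater than $3n$, the random variables $f(\Lambda_{Q_n(x)})\,\mathbf 1\{\sup_{y\in Q_n(x)\cap\mathbb Q^d}R_y<n\}$, $x\in\varphi$, are independent. It is asymptotically essentially connected if it is stabilizing with some field $R$ of stabilization radii such that, almost surely, for all integers $n\ge1$ with $\sup_{y\in Q_{2n}\cap\mathbb Q^d}R_y<n/2$, the support of $\Lambda_{Q_n}$ is non-empty and is contained in a connected component of the support of $\Lambda_{Q_{2n}}$. Then, if $\Lambda$ is asymptotically essentially connected, $\lambda_c(r)<\infty$ for every $r>0$. -/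

import Mathlib

open MeasureTheory ProbabilityTheory Filter Topology
open scoped ENNReal NNReal

noncomputable section

namespace CoxPercolation

/-- `ℝ^d` with the Euclidean norm. -/
abbrev Space (d : ℕ) : Type := EuclideanSpace ℝ (Fin d)

/-- The closed cube `Q_s(x) = x + [-s/2, s/2]^d`. -/
def cube {d : ℕ} (s : ℝ) (x : Space d) : Set (Space d) :=
  {y | ∀ i, |y i - x i| ≤ s / 2}

/-- The set `ℚ^d` of points with rational coordinates. -/
def rationalPoints (d : ℕ) : Set (Space d) :=
  {y | ∀ i, ∃ q : ℚ, y i = (q : ℝ)}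

/-- The measure `μ` seen from `x`, that is, `B ↦ μ (B + x)`. -/
def shift {d : ℕ} (x : Space d) (μ : Measure (Space d)) : Measure (Space d) :=
  μ.map (fun y => y - x)

/-- A stationary random measure `Λ` on `ℝ^d`, measurable for the evaluation `σ`-algebra on the
space of Borel measures, with `E[Λ([0,1]^d)] = 1`. -/
structure IsStationaryRandomMeasure {d : ℕ} {Ω : Type*} [MeasurableSpace Ω]
    (P : Measure Ω) (Λ : Ω → Measure (Space d)) : Prop where
  measurable : Measurable Λ
  stationary : ∀ x : Space d, IdentDistrib (fun ω => shift x (Λ ω)) Λ P P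
  intensity : ∫⁻ ω, Λ ω {y | ∀ i, 0 ≤ y i ∧ y i ≤ 1} ∂P = 1

/-- `sup {R_y : y ∈ Q_s(x) ∩ ℚ^d}` as an element of `[0, ∞]`. -/
def supRadius {d : ℕ} {Ω : Type*} (R : Space d → Ω → ℝ≥0∞) (s : ℝ) (x : Space d) (ω : Ω) :
    ℝ≥0∞ :=
  ⨆ y ∈ cube s x ∩ rationalPoints d, R y ω

/-- `R` is a field of stabilization radii for the random measure `Λ`. -/
structure IsStabilizationField {d : ℕ} {Ω : Type*} [MeasurableSpace Ω]
    (P : Measure Ω) (Λ : Ω → Measure (Space d)) (R : Space d → Ω → ℝ≥0∞) : Prop where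
  measurable : ∀ y, Measurable (R y)
  /-- Joint stationarity; the space of fields carries the product `σ`-algebra. -/
  jointly_stationary : ∀ x : Space d,
    IdentDistrib (fun ω => (shift x (Λ ω), fun y : Space d => R (y + x) ω))
      (fun ω => (Λ ω, fun y : Space d => R y ω)) P P
  tendsto_one :
    Tendsto (fun n : ℕ => P {ω | supRadius R n 0 ω < (n : ℝ≥0∞)}) atTop (𝓝 1)
  indep : ∀ n : ℕ, 1 ≤ n → ∀ f : Measure (Space d) → ℝ≥0, Measurable f →
    (∃ C : ℝ≥0, ∀ μ, f μ ≤ C) →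
    ∀ φ : Finset (Space d), (∀ x ∈ φ, ∀ y ∈ φ, y ≠ x → 3 * (n : ℝ) < dist x y) →
    iIndepFun (fun (x : φ) => Set.indicator {ω | supRadius R n (x : Space d) ω < (n : ℝ≥0∞)}
      (fun ω => f ((Λ ω).restrict (cube n (x : Space d))))) P

/-- `Λ` is asymptotically essentially connected: it is stabilizing with some field `R` of radii
such that, almost surely, for all `n ≥ 1`, whenever the radii in `Q_{2n}` are bounded by a number
below `n / 2`, the support of `Λ` restricted to `Q_n` is non-empty and contained in a connected
component of the support of `Λ` restricted to `Q_{2n}`. -/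
def IsAsymptoticallyEssentiallyConnected {d : ℕ} {Ω : Type*} [MeasurableSpace Ω]
    (P : Measure Ω) (Λ : Ω → Measure (Space d)) : Prop :=
  ∃ R : Space d → Ω → ℝ≥0∞, IsStabilizationField P Λ R ∧
    ∀ᵐ ω ∂P, ∀ n : ℕ, 1 ≤ n → supRadius R (2 * n) 0 ω < (n : ℝ≥0∞) / 2 →
      ((Λ ω).restrict (cube n 0)).support.Nonempty ∧
      ∃ x ∈ ((Λ ω).restrict (cube (2 * n) 0)).support,
        ((Λ ω).restrict (cube n 0)).support ⊆
          connectedComponentIn ((Λ ω).restrict (cube (2 * n) 0)).support x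

/-- A locally finite counting measure, i.e. a locally finite configuration of points (possibly
with multiplicities). -/
def IsCountingMeasure {d : ℕ} (ξ : Measure (Space d)) : Prop :=
  ∀ B : Set (Space d), MeasurableSet B → Bornology.IsBounded B → ∃ k : ℕ, ξ B = k

/-- `X` is a Cox process with random intensity measure `l Λ`: a point process which, conditioned
on `Λ`, is a Poisson point process with intensity measure `l Λ`. That is, conditioned on `Λ`, the
numbers of points in disjoint bounded Borel sets `B i` are independent and Poisson distributed with
parameters `l Λ(B i)`; the conditioning is expressed by integrating over the events `{Λ ∈ A}`. -/
structure IsCoxProcess {d : ℕ} {Ω : Type*} [MeasurableSpace Ω]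
    (P : Measure Ω) (Λ : Ω → Measure (Space d)) (l : ℝ≥0) (X : Ω → Measure (Space d)) :
    Prop where
  measurable : Measurable X
  counting : ∀ᵐ ω ∂P, IsCountingMeasure (X ω)
  poisson : ∀ (k : ℕ) (B : Fin k → Set (Space d)),
    (∀ i, MeasurableSet (B i)) → (∀ i, Bornology.IsBounded (B i)) →
    Pairwise (Function.onFun Disjoint B) →
    ∀ (m : Fin k → ℕ) (A : Set (Measure (Space d))), MeasurableSet A →
      P (Λ ⁻¹' A ∩ {ω | ∀ i, X ω (B i) = (m i : ℝ≥0∞)}) =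
        ∫⁻ ω in Λ ⁻¹' A, ∏ i, poissonMeasure (l * (Λ ω (B i)).toNNReal) {m i} ∂P

/-- The points of a configuration. -/
def points {d : ℕ} (ξ : Measure (Space d)) : Set (Space d) :=
  {x | ξ {x} ≠ 0}

/-- The Gilbert graph `g_r(ξ)`: two distinct points of the configuration are adjacent if their
distance is less than `r`. -/
def gilbertGraph {d : ℕ} (r : ℝ) (ξ : Measure (Space d)) : SimpleGraph (points ξ) where
  Adj x y := x ≠ y ∧ dist (x : Space d) (y : Space d) < r
  symm := ⟨fun _ _ h => ⟨h.1.symm, by rw [dist_comm]; exact h.2⟩⟩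
  loopless := ⟨fun _ h => h.1 rfl⟩

/-- `g_r(ξ)` contains an infinite connected component. -/
def Percolates {d : ℕ} (r : ℝ) (ξ : Measure (Space d)) : Prop :=
  ∃ C : (gilbertGraph r ξ).ConnectedComponent, C.supp.Infinite

/-- The critical intensity `λ_c(r) = inf {λ > 0 : P(g_r(X^λ) percolates) > 0}`, an element of
`[0, ∞]`, which is `∞` if there is no such `λ`. -/
def criticalIntensity {d : ℕ} {Ω : Type*} [MeasurableSpace Ω]
    (P : Measure Ω) (X : ℝ≥0 → Ω → Measure (Space d)) (r : ℝ) : ℝ≥0∞ :=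
  ⨅ (l : ℝ≥0) (_ : 0 < l ∧ 0 < P {ω | Percolates r (X l ω)}), (l : ℝ≥0∞)

end CoxPercolation

end

/-!
A coarse-graining argument. Cut `ℝ^d` into cells of side length `1 / q`, so small that points in
cells at sup-distance at most `3` are adjacent in the Gilbert graph, and attach to each site of
`ℤ²`, embedded as a coordinate plane, a large window of cells. A site is good if the cells charged
by `Λ` near the middle of its window are connected within the charged cells of the window and if
every charged cell of the window contains a point of the Cox process. Clusters of good sites give
clusters of the Gilbert graph. Asymptotic essential connectedness makes the first requirement
likely on a large scale, and, the scale being fixed, a large intensity makes the second one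
likely. Stabilization makes distant sites independent up to small errors, so the bad sites are
dominated by a subcritical field and Peierls' argument applies. Its topological input, that a
finite cluster is surrounded by a king-connected set of bad sites, is proved by a potential
argument: the edges leaving the cluster through one component of its boundary form a closed flow,
hence a gradient, and the potential cannot take different values at the two ends of an axis unless
this component meets both half-axes.
-/

noncomputable section

namespace CoxPercolation

/-- The nearest-neighbour graph on `ℤ²`. -/
def squareLattice : SimpleGraph (ℤ × ℤ) :=
  SimpleGraph.hasse ℤ □ SimpleGraph.hasse ℤ

/-- The graph of king moves on `ℤ²`, whose paths are the dual paths of `squareLattice`. -/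
def kingGraph : SimpleGraph (ℤ × ℤ) where
  Adj u v := u ≠ v ∧ |u.1 - v.1| ≤ 1 ∧ |u.2 - v.2| ≤ 1
  symm := ⟨fun u v h => by rw [abs_sub_comm v.1, abs_sub_comm v.2]; exact ⟨h.1.symm, h.2⟩⟩
  loopless := ⟨fun _ h => h.1 rfl⟩

/-- The vertices outside `C` adjacent to a vertex of `C`. -/
def outerBoundary {V : Type*} (G : SimpleGraph V) (C : Set V) : Set V :=
  {v | v ∉ C ∧ ∃ u ∈ C, G.Adj u v}

theorem squareLattice_adj {u v : ℤ × ℤ} :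
    squareLattice.Adj u v ↔
      (v.1 = u.1 + 1 ∨ u.1 = v.1 + 1) ∧ u.2 = v.2 ∨
        (v.2 = u.2 + 1 ∨ u.2 = v.2 + 1) ∧ u.1 = v.1 := by
  simp only [squareLattice, SimpleGraph.boxProd_adj, SimpleGraph.hasse_adj,
    Order.covBy_iff_add_one_eq, eq_comm]

theorem squareLattice_adj_right (x y : ℤ) : squareLattice.Adj (x, y) (x + 1, y) :=
  squareLattice_adj.2 (.inl ⟨.inl rfl, rfl⟩)

theorem squareLattice_adj_up (x y : ℤ) : squareLattice.Adj (x, y) (x, y + 1) :=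
  squareLattice_adj.2 (.inr ⟨.inl rfl, rfl⟩)

theorem squareLattice_le_kingGraph : squareLattice ≤ kingGraph := by
  intro u v huv
  refine ⟨huv.ne, ?_⟩
  rw [abs_le, abs_le]
  have := squareLattice_adj.1 huv
  omega

theorem exists_antidifference {A : Type*} [AddCommGroup A] (f : ℤ → A) :
    ∃ g : ℤ → A, ∀ n, g (n + 1) = g n + f n := by
  let g : ℤ → A
    | .ofNat n => ∑ i ∈ Finset.range n, f i
    | .negSucc n => -∑ i ∈ Finset.range (n + 1), f (.negSucc i)
  refine ⟨g, ?_⟩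
  rintro (n | _ | n)
  · exact Finset.sum_range_succ (fun i : ℕ => f i) n
  · change 0 = -∑ i ∈ Finset.range 1, f (.negSucc i) + f (.negSucc 0)
    rw [Finset.sum_range_one, neg_add_cancel]
  · change -∑ i ∈ Finset.range (n + 1), f (.negSucc i) =
      -∑ i ∈ Finset.range (n + 2), f (.negSucc i) + f (.negSucc (n + 1))
    rw [Finset.sum_range_succ _ (n + 1)]
    abel

theorem exists_potential {A : Type*} [AddCommGroup A] {F : ℤ × ℤ → ℤ × ℤ → A}
    (hanti : ∀ u v, F v u = -F u v)
    (hclosed : ∀ x y, F (x, y) (x + 1, y) + F (x + 1, y) (x + 1, y + 1) =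
      F (x, y) (x, y + 1) + F (x, y + 1) (x + 1, y + 1)) :
    ∃ h : ℤ × ℤ → A, ∀ u v, squareLattice.Adj u v → h v = h u + F u v := by
  choose a ha using fun y => exists_antidifference fun x => F (x, y) (x + 1, y)
  obtain ⟨b, hb⟩ := exists_antidifference fun y => F (0, y) (0, y + 1)
  let h : ℤ × ℤ → A := fun u => b u.2 + (a u.2 u.1 - a u.2 0)
  have right (x y : ℤ) : h (x + 1, y) = h (x, y) + F (x, y) (x + 1, y) := by
    change b y + (a y (x + 1) - a y 0) = b y + (a y x - a y 0) + F (x, y) (x + 1, y)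
    rw [ha]
    abel
  have up (x y : ℤ) : h (x, y + 1) = h (x, y) + F (x, y) (x, y + 1) := by
    induction x with
    | zero => simp [h, hb]
    | succ i ih =>
      rw [right, ih, right, add_assoc, ← hclosed, ← add_assoc]
    | pred i ih =>
      have hr := right (-i - 1) y
      have hr' := right (-i - 1) (y + 1)
      have hc := hclosed (-i - 1) y
      rw [sub_add_cancel] at hr hr' hc
      rw [ih, hr, add_assoc, hc, ← add_assoc] at hr'
      exact (add_right_cancel hr').symm
  refine ⟨h, fun ⟨x, y⟩ ⟨x', y'⟩ huv => ?_⟩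
  rw [squareLattice_adj] at huv
  dsimp only at huv
  obtain ⟨rfl | rfl, rfl⟩ | ⟨rfl | rfl, rfl⟩ := huv
  · exact right x y
  · rw [hanti (x', y), right, add_neg_cancel_right]
  · exact up x y
  · rw [hanti (x, y'), up, add_neg_cancel_right]

open Classical in
/-- The flow through the edges between `C` and `K`, counted positively from `C` to `K`. -/
def boundaryFlow (C K : Set (ℤ × ℤ)) (u v : ℤ × ℤ) : ℤ :=
  (if u ∈ C ∧ v ∈ K then 1 else 0) - if v ∈ C ∧ u ∈ K then 1 else 0

theorem boundaryFlow_closed {C K : Set (ℤ × ℤ)} (hK : K ⊆ outerBoundary squareLattice C)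
    (hclosed : ∀ u ∈ K, ∀ v ∈ outerBoundary squareLattice C, kingGraph.Adj u v → v ∈ K)
    (x y : ℤ) :
    boundaryFlow C K (x, y) (x + 1, y) + boundaryFlow C K (x + 1, y) (x + 1, y + 1) =
      boundaryFlow C K (x, y) (x, y + 1) + boundaryFlow C K (x, y + 1) (x + 1, y + 1) := by
  classical
  let S : Set (ℤ × ℤ) := {v | (v.1 = x ∨ v.1 = x + 1) ∧ (v.2 = y ∨ v.2 = y + 1)}
  -- On a square that meets `K`, the flow is the gradient of the indicator function of `C`.
  obtain ⟨f, hf⟩ : ∃ f : ℤ × ℤ → ℤ, ∀ u ∈ S, ∀ v ∈ S, squareLattice.Adj u v →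
      boundaryFlow C K u v = f u - f v := by
    by_cases hSK : ∃ w ∈ S, w ∈ K
    · obtain ⟨w, hwS, hwK⟩ := hSK
      have mem_K (u) (hu : u ∈ C) (v) (hv : v ∈ S) (huv : squareLattice.Adj u v) (hvC : v ∉ C) :
          v ∈ K := by
        obtain rfl | hne := eq_or_ne w v
        · exact hwK
        refine hclosed w hwK v ⟨hvC, u, hu, huv⟩ ⟨hne, ?_⟩
        rw [abs_le, abs_le]
        obtain ⟨_, _⟩ := hwS
        obtain ⟨_, _⟩ := hv
        omega
      have notMem_K (u) (hu : u ∈ C) : u ∉ K := fun h => (hK h).1 hu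
      refine ⟨fun u => if u ∈ C then 1 else 0, fun u hu v hv huv => ?_⟩
      have := mem_K u
      have := mem_K v
      grind [boundaryFlow, SimpleGraph.Adj.symm]
    · push Not at hSK
      exact ⟨0, fun u hu v hv _ => by simp [boundaryFlow, hSK u hu, hSK v hv]⟩
  rw [hf _ (by simp [S]) _ (by simp [S]) (squareLattice_adj_right x y),
    hf _ (by simp [S]) _ (by simp [S]) (squareLattice_adj_up (x + 1) y),
    hf _ (by simp [S]) _ (by simp [S]) (squareLattice_adj_up x y),
    hf _ (by simp [S]) _ (by simp [S]) (squareLattice_adj_right x (y + 1))]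
  ring

theorem eq_of_reachable {V α : Type*} {G : SimpleGraph V} {f : V → α}
    (hf : ∀ u v, G.Adj u v → f u = f v) {u v : V} (huv : G.Reachable u v) : f u = f v := by
  obtain ⟨w⟩ := huv
  induction w with
  | nil => rfl
  | cons h _ ih => exact (hf _ _ h).trans ih

theorem eq_of_forall_add_one_eq {α : Type*} {f : ℤ → α} {a b : ℤ} (hab : a ≤ b)
    (hf : ∀ n, a ≤ n → n < b → f (n + 1) = f n) : f b = f a := by
  induction b, hab using Int.leInduction with
  | base => rfl
  | succ n han ih =>
    exact (hf n han (by omega)).trans (ih fun m ham hmn => hf m ham (by omega))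

theorem eq_of_constant_off_box {α : Type*} {h : ℤ × ℤ → α} {C : Set (ℤ × ℤ)}
    (hh : ∀ u v, squareLattice.Adj u v → u ∉ C → v ∉ C → h v = h u) (hC : C.Finite)
    {s t : ℤ} (hs : ∀ x, s ≤ x → (x, 0) ∉ C) (ht : ∀ x, x ≤ t → (x, 0) ∉ C) :
    h (s, 0) = h (t, 0) := by
  obtain ⟨M, hM⟩ : ∃ M : ℤ, ∀ v ∈ insert (s, 0) (insert (t, 0) C), |v.1| < M ∧ |v.2| < M := by
    obtain ⟨M, hM⟩ := (((hC.insert (t, 0)).insert (s, 0)).image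
      fun v : ℤ × ℤ => max |v.1| |v.2|).bddAbove
    exact ⟨M + 1, fun v hv => max_lt_iff.1 (Int.lt_add_one_of_le (hM ⟨v, hv, rfl⟩))⟩
  have hMC (v : ℤ × ℤ) (hv : |v.1| = M ∨ |v.2| = M) : v ∉ C := fun h => by
    have := hM v (.inr (.inr h))
    omega
  have hsM := abs_lt.1 (hM (s, 0) (.inl rfl)).1
  have htM := abs_lt.1 (hM (t, 0) (.inr (.inl rfl))).1
  have hM0 : |M| = M := abs_of_pos (by omega)
  have hM1 : |-M| = M := by rw [abs_neg, hM0]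
  have right {a b y : ℤ} (hab : a ≤ b) (hy : ∀ x, a ≤ x → x ≤ b → (x, y) ∉ C) :
      h (b, y) = h (a, y) :=
    eq_of_forall_add_one_eq (f := fun x => h (x, y)) hab fun n ha hb =>
      hh _ _ (squareLattice_adj_right n y) (hy n ha (by omega)) (hy _ (by omega) (by omega))
  have up {x : ℤ} (hx : |x| = M) : h (x, M) = h (x, 0) :=
    eq_of_forall_add_one_eq (f := fun y => h (x, y)) (by omega) fun n _ _ =>
      hh _ _ (squareLattice_adj_up x n) (hMC _ (.inl hx)) (hMC _ (.inl hx))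
  calc h (s, 0) = h (M, 0) := (right (by omega) fun x hx _ => hs x hx).symm
    _ = h (M, M) := (up hM0).symm
    _ = h (-M, M) := right (by omega) fun x _ _ => hMC _ (.inr hM0)
    _ = h (-M, 0) := up hM1
    _ = h (t, 0) := (right (by omega) fun x _ hx => ht x hx).symm

theorem exists_extreme_on_axis {C : Set (ℤ × ℤ)} (hC : C.Finite) (h0 : 0 ∈ C) :
    ∃ s t : ℤ, t ≤ 0 ∧ 0 ≤ s ∧ (s, 0) ∈ C ∧ (t, 0) ∈ C ∧
      ∀ x, x < t ∨ s < x → (x, 0) ∉ C := by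
  have hfin : {x : ℤ | (x, 0) ∈ C}.Finite :=
    hC.preimage (Prod.mk_left_injective (0 : ℤ)).injOn
  obtain ⟨s, hs⟩ := hfin.exists_maximal ⟨0, h0⟩
  obtain ⟨t, ht⟩ := hfin.exists_minimal ⟨0, h0⟩
  refine ⟨s, t, ?_, ?_, hs.prop, ht.prop, ?_⟩
  · exact le_of_not_gt fun h => ht.not_prop_of_lt h h0
  · exact le_of_not_gt fun h => hs.not_prop_of_gt h h0
  · rintro x (hx | hx)
    · exact ht.not_prop_of_lt hx
    · exact hs.not_prop_of_gt hx

theorem exists_boundary_reachable {C : Set (ℤ × ℤ)} (hC : C.Finite) (h0 : 0 ∈ C)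
    (hconn : (squareLattice.induce C).Preconnected) :
    ∃ p q : outerBoundary squareLattice C, 0 < p.1.1 ∧ q.1.1 < 0 ∧ p.1.2 = 0 ∧ q.1.2 = 0 ∧
      (kingGraph.induce (outerBoundary squareLattice C)).Reachable p q := by
  obtain ⟨s, t, ht0, hs0, hsC, htC, hst⟩ := exists_extreme_on_axis hC h0
  have hs_adj : squareLattice.Adj (s, 0) (s + 1, 0) := squareLattice_adj_right s 0
  have ht_adj : squareLattice.Adj (t, 0) (t - 1, 0) :=
    squareLattice_adj.2 (.inl ⟨.inr (sub_add_cancel t 1).symm, rfl⟩)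
  let p : outerBoundary squareLattice C :=
    ⟨(s + 1, 0), hst _ (by omega), (s, 0), hsC, hs_adj⟩
  let q : outerBoundary squareLattice C :=
    ⟨(t - 1, 0), hst _ (by omega), (t, 0), htC, ht_adj⟩
  let K : Set (ℤ × ℤ) := Subtype.val ''
    {v | (kingGraph.induce (outerBoundary squareLattice C)).Reachable p v}
  have hKC : K ⊆ outerBoundary squareLattice C := Subtype.coe_image_subset _ _
  suffices hqK : (t - 1, 0) ∈ K by
    obtain ⟨v, hv, hvq⟩ := hqK
    obtain rfl : v = q := Subtype.ext hvq
    exact ⟨p, q, Int.lt_add_one_of_le hs0, Int.sub_one_lt_of_le ht0, rfl, rfl, hv⟩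
  have hclosed : ∀ u ∈ K, ∀ v ∈ outerBoundary squareLattice C, kingGraph.Adj u v → v ∈ K := by
    rintro _ ⟨u, hu, rfl⟩ v hv huv
    exact ⟨⟨v, hv⟩, hu.trans (SimpleGraph.Adj.reachable huv), rfl⟩
  obtain ⟨h, hh⟩ := exists_potential (F := boundaryFlow C K)
    (fun u v => (neg_sub _ _).symm) (boundaryFlow_closed hKC hclosed)
  have notMem_K {u} (hu : u ∈ C) : u ∉ K := fun huK => (hKC huK).1 hu
  have h_inside : h (s, 0) = h (t, 0) :=
    eq_of_reachable (G := squareLattice.induce C) (f := fun v => h v.1)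
      (fun u v huv => by
        simp [hh u v huv, boundaryFlow, notMem_K u.2, notMem_K v.2])
      (hconn ⟨_, hsC⟩ ⟨_, htC⟩)
  have h_outside : h (s + 1, 0) = h (t - 1, 0) := by
    refine eq_of_constant_off_box (C := C) (fun u v huv hu hv => ?_) hC
      (fun x hx => hst x (by omega)) (fun x hx => hst x (by omega))
    simp [hh u v huv, boundaryFlow, hu, hv]
  have h_right : h (s + 1, 0) = h (s, 0) + 1 := by
    rw [hh _ _ hs_adj]
    simp [boundaryFlow, hsC, notMem_K hsC, show (s + 1, 0) ∈ K from ⟨p, .refl _, rfl⟩]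
  by_contra hqK
  have h_left : h (t - 1, 0) = h (t, 0) := by
    rw [hh _ _ ht_adj]
    simp [boundaryFlow, hqK, notMem_K htC]
  omega

/-- Site percolation on `ℤ²` with the set `S` of open sites: there is an infinite open cluster. -/
def SitePercolates (S : Set (ℤ × ℤ)) : Prop :=
  ∃ C : (squareLattice.induce S).ConnectedComponent, C.supp.Infinite

theorem kingGraph_sub_le_length {u v : ℤ × ℤ} (w : kingGraph.Walk u v) : u.1 - v.1 ≤ w.length := by
  induction w with
  | nil => simp
  | cons h _ ih =>
    rw [SimpleGraph.Walk.length_cons, Nat.cast_succ]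
    have := (abs_le.1 h.2.1).2
    omega

theorem preconnected_induce_image_supp {V : Type*} {G : SimpleGraph V} {S : Set V}
    (C : (G.induce S).ConnectedComponent) :
    (G.induce (Subtype.val '' C.supp)).Preconnected := by
  let f : C.toSimpleGraph →g G.induce (Subtype.val '' C.supp) :=
    ⟨fun v => ⟨v.1.1, v.1, v.2, rfl⟩, fun h => h⟩
  refine C.connected_toSimpleGraph.preconnected.map f ?_
  rintro ⟨_, v, hv, rfl⟩
  exact ⟨⟨v, hv⟩, rfl⟩

theorem outerBoundary_image_supp_subset {V : Type*} {G : SimpleGraph V} {S : Set V}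
    (C : (G.induce S).ConnectedComponent) : outerBoundary G (Subtype.val '' C.supp) ⊆ Sᶜ := by
  rintro v ⟨hv, _, ⟨u, hu, rfl⟩, huv⟩ hvS
  refine hv ⟨⟨v, hvS⟩, ?_, rfl⟩
  exact C.mem_supp_of_adj_mem_supp hu huv

theorem exists_isPath_of_not_sitePercolates {S : Set (ℤ × ℤ)} (hS : ¬SitePercolates S) :
    ∃ (a : ℕ) (v : ℤ × ℤ) (w : kingGraph.Walk ((a : ℤ), 0) v),
      w.IsPath ∧ w.length = a ∧ ∀ z ∈ w.support, z ∉ S := by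
  by_cases h0 : (0 : ℤ × ℤ) ∈ S
  · let C := (squareLattice.induce S).connectedComponentMk ⟨0, h0⟩
    have hC : C.supp.Finite := by
      by_contra hinf
      exact hS ⟨C, hinf⟩
    obtain ⟨⟨⟨x, y⟩, hp⟩, q, hx, hq, rfl, -, hpq⟩ :=
      exists_boundary_reachable (hC.image Subtype.val) ⟨⟨0, h0⟩, rfl, rfl⟩
        (preconnected_induce_image_supp C)
    dsimp only at hx
    lift x to ℕ using hx.le
    obtain ⟨w, hw⟩ := hpq.exists_isPath
    let w' : kingGraph.Walk ((x : ℤ), 0) q.1 := w.map (SimpleGraph.Embedding.induce _).toHom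
    have hlen : x ≤ w'.length := by
      have : (x : ℤ) - q.1.1 ≤ w'.length := kingGraph_sub_le_length w'
      omega
    refine ⟨x, _, w'.take x, (hw.map Subtype.val_injective).take x, ?_, fun z hz => ?_⟩
    · rw [SimpleGraph.Walk.take_length, min_eq_left hlen]
    · rw [SimpleGraph.Walk.support_take] at hz
      have hsupp : w'.support = w.support.map Subtype.val := SimpleGraph.Walk.support_map _ w
      obtain ⟨v, -, rfl⟩ := List.mem_map.1 (hsupp ▸ List.mem_of_mem_take hz)
      exact outerBoundary_image_supp_subset C v.2
  · refine ⟨0, _, .nil, .nil, rfl, fun z hz => ?_⟩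
    rwa [List.mem_singleton.1 hz]

theorem exists_finset_walk_support {V : Type*} {G : SimpleGraph V} [G.LocallyFinite] {Δ : ℕ}
    (hΔ : ∀ u, G.degree u ≤ Δ) (n : ℕ) (u : V) :
    ∃ L : Finset (List V), L.card ≤ Δ ^ n ∧
      ∀ v (w : G.Walk u v), w.length = n → w.support ∈ L := by
  classical
  induction n generalizing u with
  | zero =>
    refine ⟨{[u]}, by simp, fun v w hw => ?_⟩
    cases w with
    | nil => simp
    | cons => simp at hw
  | succ n ih =>
    choose L hcard hL using ih
    refine ⟨(G.neighborFinset u).biUnion fun v => (L v).image (u :: ·), ?_, fun v w hw => ?_⟩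
    · rw [pow_succ']
      refine (Finset.card_biUnion_le_card_mul _ _ _ fun v _ => ?_).trans
        (Nat.mul_le_mul_right _ (hΔ u))
      exact Finset.card_image_le.trans (hcard v)
    · cases w with
      | nil => simp at hw
      | cons h w =>
        rw [SimpleGraph.Walk.length_cons, Nat.add_right_cancel_iff] at hw
        exact Finset.mem_biUnion.2 ⟨_, (G.mem_neighborFinset _ _).2 h,
          Finset.mem_image_of_mem _ (hL _ _ w hw)⟩

theorem measure_exists_isPath_le {V Ω : Type*} {G : SimpleGraph V} [G.LocallyFinite] {Δ : ℕ}
    (hΔ : ∀ u, G.degree u ≤ Δ) [MeasurableSpace Ω] {P : Measure Ω} {bad : V → Set Ω} {p : ℝ≥0∞}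
    (hbad : ∀ S : Finset V, P {ω | ∀ z ∈ S, ω ∈ bad z} ≤ p ^ S.card) (n : ℕ) (u : V) :
    P {ω | ∃ v, ∃ w : G.Walk u v, w.IsPath ∧ w.length = n ∧ ∀ z ∈ w.support, ω ∈ bad z} ≤
      Δ ^ n * p ^ (n + 1) := by
  classical
  obtain ⟨L, hcard, hL⟩ := exists_finset_walk_support hΔ n u
  let L' := L.filter fun l => l.Nodup ∧ l.length = n + 1
  calc P {ω | ∃ v, ∃ w : G.Walk u v, w.IsPath ∧ w.length = n ∧ ∀ z ∈ w.support, ω ∈ bad z}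
      ≤ P (⋃ l ∈ L', {ω | ∀ z ∈ l.toFinset, ω ∈ bad z}) := by
        refine measure_mono ?_
        rintro ω ⟨v, w, hw, hn, hω⟩
        refine Set.mem_biUnion (Finset.mem_filter.2 ⟨hL v w hn, hw.support_nodup, ?_⟩)
          fun z hz => hω z (List.mem_toFinset.1 hz)
        rw [SimpleGraph.Walk.length_support, hn]
    _ ≤ ∑ l ∈ L', P {ω | ∀ z ∈ l.toFinset, ω ∈ bad z} := measure_biUnion_finset_le _ _
    _ ≤ ∑ _l ∈ L', p ^ (n + 1) := by
        refine Finset.sum_le_sum fun l hl => ?_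
        obtain ⟨-, hnodup, hlen⟩ := Finset.mem_filter.1 hl
        rw [← hlen, ← List.toFinset_card_of_nodup hnodup]
        exact hbad l.toFinset
    _ ≤ Δ ^ n * p ^ (n + 1) := by
        rw [Finset.sum_const, nsmul_eq_mul]
        gcongr
        exact_mod_cast (Finset.card_filter_le _ _).trans hcard

instance : kingGraph.LocallyFinite := fun u =>
  Fintype.ofFinset ((Finset.Icc (u - 1) (u + 1)).erase u) fun v => by
    rw [Finset.mem_erase, Finset.mem_Icc, SimpleGraph.mem_neighborSet]
    refine and_congr ne_comm ?_
    simp only [Prod.le_def, abs_le, Prod.fst_sub, Prod.snd_sub, Prod.fst_add, Prod.snd_add,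
      Prod.fst_one, Prod.snd_one]
    omega

theorem kingGraph_degree (u : ℤ × ℤ) : kingGraph.degree u = 8 := by
  have h : kingGraph.neighborFinset u = (Finset.Icc (u - 1) (u + 1)).erase u :=
    Set.toFinset_ofFinset _ _
  rw [← SimpleGraph.card_neighborFinset_eq_degree, h, Finset.card_erase_of_mem (by simp),
    Finset.card_Icc_prod, Int.card_Icc, Int.card_Icc]
  simp only [Prod.fst_sub, Prod.snd_sub, Prod.fst_add, Prod.snd_add, Prod.fst_one, Prod.snd_one]
  rw [show u.1 + 1 + 1 - (u.1 - 1) = 3 by ring, show u.2 + 1 + 1 - (u.2 - 1) = 3 by ring]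
  rfl

/-- The distinct sites of `T` are at distance at least `N` from each other in the supremum norm. -/
def IsSeparated (N : ℕ) (T : Set (ℤ × ℤ)) : Prop :=
  T.Pairwise fun u v => (N : ℤ) ≤ |u.1 - v.1| ∨ (N : ℤ) ≤ |u.2 - v.2|

theorem exists_isSeparated_subset {N : ℕ} (hN : 0 < N) (S : Finset (ℤ × ℤ)) :
    ∃ T ⊆ S, S.card ≤ N ^ 2 * T.card ∧ IsSeparated N T := by
  classical
  have : NeZero N := ⟨hN.ne'⟩
  let f : ℤ × ℤ → ZMod N × ZMod N := fun z => (z.1, z.2)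
  obtain ⟨c, -, hc⟩ : ∃ c ∈ Finset.univ, (S.card / N ^ 2 : ℚ) ≤ (S.filter fun z => f z = c).card :=
    Finset.exists_le_card_fiber_of_nsmul_le_card_of_maps_to (fun _ _ => Finset.mem_univ _)
      Finset.univ_nonempty (by
        rw [Finset.card_univ, Fintype.card_prod, ZMod.card, nsmul_eq_mul]
        push_cast
        rw [← sq, mul_div_cancel₀ _ (by positivity)])
  refine ⟨S.filter fun z => f z = c, Finset.filter_subset _ _, ?_, fun u hu v hv huv => ?_⟩
  · rw [div_le_iff₀' (by positivity)] at hc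
    exact_mod_cast hc
  · have e : f u = f v := (Finset.mem_filter.1 hu).2.trans (Finset.mem_filter.1 hv).2.symm
    simp only [f, Prod.mk.injEq, ZMod.intCast_eq_intCast_iff_dvd_sub] at e
    dsimp only
    rw [abs_sub_comm u.1, abs_sub_comm u.2]
    by_cases h1 : u.1 = v.1
    · have h2 : v.2 - u.2 ≠ 0 := fun h => huv (Prod.ext h1 (by omega))
      exact .inr (Int.le_of_dvd (abs_pos.2 h2) ((dvd_abs _ _).2 e.2))
    · exact .inl (Int.le_of_dvd (abs_pos.2 (by omega)) ((dvd_abs _ _).2 e.1))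

theorem measure_forall_mem_le_pow {Ω : Type*} [MeasurableSpace Ω] {P : Measure Ω}
    {bad : ℤ × ℤ → Set Ω} {N : ℕ} (hN : 0 < N) {p : ℝ≥0∞} (hp : p ≤ 1)
    (h : ∀ T : Finset (ℤ × ℤ), IsSeparated N T →
      P {ω | ∀ z ∈ T, ω ∈ bad z} ≤ (p ^ N ^ 2) ^ T.card) (S : Finset (ℤ × ℤ)) :
    P {ω | ∀ z ∈ S, ω ∈ bad z} ≤ p ^ S.card := by
  obtain ⟨T, hTS, hcard, hT⟩ := exists_isSeparated_subset hN S
  calc P {ω | ∀ z ∈ S, ω ∈ bad z} ≤ P {ω | ∀ z ∈ T, ω ∈ bad z} :=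
        measure_mono fun ω hω z hz => hω z (hTS hz)
    _ ≤ p ^ (N ^ 2 * T.card) := by rw [pow_mul]; exact h T hT
    _ ≤ p ^ S.card := pow_le_pow_right_of_le_one' hp hcard

/-- Peierls' argument: the expected number of king paths of closed sites that may surround the
origin is less than one. -/
theorem not_ae_not_sitePercolates {Ω : Type*} [MeasurableSpace Ω] {P : Measure Ω}
    [IsProbabilityMeasure P] {bad : ℤ × ℤ → Set Ω} {p : ℝ≥0∞} (hp : 9 * p < 1)
    (h : ∀ S : Finset (ℤ × ℤ), P {ω | ∀ z ∈ S, ω ∈ bad z} ≤ p ^ S.card) :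
    ¬∀ᵐ ω ∂P, ¬SitePercolates {z | ω ∉ bad z} := by
  intro hae
  let E (a : ℕ) : Set Ω := {ω | ∃ v, ∃ w : kingGraph.Walk ((a : ℤ), 0) v,
    w.IsPath ∧ w.length = a ∧ ∀ z ∈ w.support, ω ∈ bad z}
  have hE (a : ℕ) : P (E a) ≤ 8 ^ a * p ^ (a + 1) := by
    exact_mod_cast measure_exists_isPath_le (fun u => (kingGraph_degree u).le) h a ((a : ℤ), 0)
  have hcover : ∀ᵐ ω ∂P, ω ∈ ⋃ a, E a := by
    filter_upwards [hae] with ω hω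
    obtain ⟨a, v, w, hw, hlen, hbad⟩ := exists_isPath_of_not_sitePercolates hω
    exact Set.mem_iUnion.2 ⟨a, v, w, hw, hlen, fun z hz => not_not.1 (hbad z hz)⟩
  have h1 : 1 ≤ p * (1 - 8 * p)⁻¹ :=
    calc 1 = P Set.univ := measure_univ.symm
      _ ≤ P (⋃ a, E a) := measure_mono_ae (hcover.mono fun _ hω _ => hω)
      _ ≤ ∑' a, P (E a) := measure_iUnion_le _
      _ ≤ ∑' a : ℕ, p * (8 * p) ^ a :=
          ENNReal.tsum_le_tsum fun a => (hE a).trans_eq (by ring)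
      _ = p * (1 - 8 * p)⁻¹ := by rw [ENNReal.tsum_mul_left, ENNReal.tsum_geometric]
  have h2 : p < 1 - 8 * p := by
    refine lt_tsub_iff_right.2 (lt_of_eq_of_lt ?_ hp)
    ring
  refine h1.not_gt ?_
  rw [← div_eq_mul_inv]
  exact ENNReal.div_lt_of_lt_mul (by rwa [one_mul])

section Cells

variable {d q : ℕ}

/-- The index of the half-open cube of side length `1 / q` of the standard grid containing `y`. -/
def gridIndex (q : ℕ) (y : Space d) : Fin d → ℤ :=
  fun i => ⌊(q : ℝ) * y i⌋

/-- The half-open cubes of side length `1 / q` that tile `ℝ^d`. -/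
def cell (q : ℕ) (w : Fin d → ℤ) : Set (Space d) :=
  gridIndex q ⁻¹' {w}

theorem mem_cell_gridIndex (q : ℕ) (y : Space d) : y ∈ cell q (gridIndex q y) :=
  rfl

theorem mem_cell_iff {w : Fin d → ℤ} {y : Space d} :
    y ∈ cell q w ↔ ∀ i, (w i : ℝ) ≤ q * y i ∧ q * y i < w i + 1 := by
  simp only [cell, gridIndex, Set.mem_preimage, Set.mem_singleton_iff, funext_iff,
    Int.floor_eq_iff]

theorem measurableSet_cell (q : ℕ) (w : Fin d → ℤ) : MeasurableSet (cell q w) := by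
  have h : Measurable (gridIndex q : Space d → Fin d → ℤ) :=
    measurable_pi_lambda _ fun i => Int.measurable_floor.comp (by fun_prop)
  exact h (measurableSet_singleton w)

theorem disjoint_cell {v w : Fin d → ℤ} (h : v ≠ w) :
    Disjoint (cell q v : Set (Space d)) (cell q w) :=
  Disjoint.preimage _ (Set.disjoint_singleton.2 h)

theorem dist_lt_of_mem_cell (hq : 0 < q) {r : ℝ} (hr : 0 < r) (hqr : 4 * d < r * q)
    {v w : Fin d → ℤ} (h : ∀ i, |v i - w i| ≤ 3) {x y : Space d} (hx : x ∈ cell q v)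
    (hy : y ∈ cell q w) : dist x y < r := by
  have hq' : (0 : ℝ) < q := by exact_mod_cast hq
  have hcoord (i : Fin d) : dist (x i) (y i) ≤ 4 / q := by
    have hxi := mem_cell_iff.1 hx i
    have hyi := mem_cell_iff.1 hy i
    have hvw : |(v i : ℝ) - w i| ≤ 3 := by exact_mod_cast h i
    rw [abs_le] at hvw
    rw [Real.dist_eq, le_div_iff₀' hq', ← abs_of_pos hq', ← abs_mul, abs_le]
    constructor <;> linarith
  rw [EuclideanSpace.dist_eq, Real.sqrt_lt' hr]
  calc ∑ i, dist (x i) (y i) ^ 2 ≤ ∑ _i : Fin d, (4 / q : ℝ) ^ 2 :=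
        Finset.sum_le_sum fun i _ => pow_le_pow_left₀ dist_nonneg (hcoord i) 2
    _ = d * (4 / q : ℝ) ^ 2 := by
        rw [Finset.sum_const, Finset.card_univ, Fintype.card_fin, nsmul_eq_mul]
    _ ≤ (d * (4 / q : ℝ)) ^ 2 := by
        rw [mul_pow]
        refine mul_le_mul_of_nonneg_right ?_ (sq_nonneg _)
        exact_mod_cast Nat.le_self_pow two_ne_zero d
    _ < r ^ 2 := by
        refine pow_lt_pow_left₀ ?_ (by positivity) two_ne_zero
        rw [mul_div_assoc', div_lt_iff₀ hq']
        linarith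

theorem isBounded_cell (hq : 0 < q) (w : Fin d → ℤ) :
    Bornology.IsBounded (cell q w : Set (Space d)) := by
  have hr : (0 : ℝ) < (4 * d + 1) / q := by positivity
  have hqr : (4 * d : ℝ) < (4 * d + 1) / q * q := by
    rw [div_mul_cancel₀ _ (by positivity)]
    exact lt_add_one _
  exact Metric.isBounded_iff.2 ⟨(4 * d + 1) / q, fun x hx y hy =>
    (dist_lt_of_mem_cell hq hr hqr (by simp) hx hy).le⟩

theorem IsCountingMeasure.exists_mem_points {ξ : Measure (Space d)} (hξ : IsCountingMeasure ξ)
    {B : Set (Space d)} (hB : MeasurableSet B) (hBb : Bornology.IsBounded B) (h : ξ B ≠ 0) :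
    ∃ x ∈ B, x ∈ points ξ := by
  obtain ⟨x, hxB, hx⟩ := Measure.nonempty_inter_support_of_pos (μ := ξ.restrict B) (s := B)
    (by rw [Measure.restrict_apply_self]; exact pos_iff_ne_zero.2 h)
  refine ⟨x, hxB, ?_⟩
  let S (n : ℕ) : Set (Space d) := Metric.closedBall x (1 / (n + 1)) ∩ B
  have hS (n : ℕ) : MeasurableSet (S n) := Metric.isClosed_closedBall.measurableSet.inter hB
  have hcount (n : ℕ) : ∃ k : ℕ, ξ (S n) = k :=
    hξ _ (hS n) (hBb.subset Set.inter_subset_right)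
  -- Every neighbourhood of `x` in `B` has positive mass, hence mass at least `1`.
  have hone (n : ℕ) : 1 ≤ ξ (S n) := by
    have hpos := (Measure.mem_support_iff_forall x).1 hx _
      (Metric.closedBall_mem_nhds x (Nat.one_div_pos_of_nat (n := n)))
    rw [Measure.restrict_apply Metric.isClosed_closedBall.measurableSet] at hpos
    obtain ⟨k, hk⟩ := hcount n
    change 0 < ξ (S n) at hpos
    rw [hk] at hpos ⊢
    exact_mod_cast hpos
  have hlim : Tendsto (fun n => ξ (S n)) atTop (𝓝 (ξ (⋂ n, S n))) := by
    refine tendsto_measure_iInter_atTop (fun n => (hS n).nullMeasurableSet)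
      (fun m n hmn => Set.inter_subset_inter_left _
        (Metric.closedBall_subset_closedBall (Nat.one_div_le_one_div hmn))) ⟨0, ?_⟩
    obtain ⟨k, hk⟩ := hcount 0
    exact hk ▸ ENNReal.natCast_ne_top k
  have hsub : ⋂ n, S n ⊆ {x} := fun y hy =>
    dist_le_zero.1 (ge_of_tendsto' tendsto_one_div_add_atTop_nhds_zero_nat
      fun n => (Set.mem_iInter.1 hy n).1)
  exact (zero_lt_one.trans_le ((ge_of_tendsto' hlim hone).trans (measure_mono hsub))).ne'

theorem eventually_abs_gridIndex_sub_le_one (q : ℕ) (p : Space d) :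
    ∀ᶠ y in 𝓝 p, ∀ i, |gridIndex q p i - gridIndex q y i| ≤ 1 := by
  refine eventually_all.2 fun i => ?_
  have hcont : Continuous fun y : Space d => (q : ℝ) * y i := by fun_prop
  filter_upwards [hcont.continuousAt.eventually_mem (Metric.ball_mem_nhds _ one_pos)] with y hy
  rw [Real.ball_eq_Ioo] at hy
  have hlt : gridIndex q p i - 1 < gridIndex q y i + 1 := by
    have := Int.floor_le ((q : ℝ) * p i)
    have := Int.lt_floor_add_one ((q : ℝ) * y i)
    have hlt : (gridIndex q p i : ℝ) - 1 < gridIndex q y i + 1 := by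
      simp only [gridIndex]
      linarith [hy.1]
    exact_mod_cast hlt
  have hgt : gridIndex q y i - 1 < gridIndex q p i + 1 := by
    have := Int.floor_le ((q : ℝ) * y i)
    have := Int.lt_floor_add_one ((q : ℝ) * p i)
    have hlt : (gridIndex q y i : ℝ) - 1 < gridIndex q p i + 1 := by
      simp only [gridIndex]
      linarith [hy.2]
    exact_mod_cast hlt
  rw [abs_le]
  omega

theorem exists_cell_of_mem_support {μ : Measure (Space d)} {Q : Set (Space d)} {p : Space d}
    (hp : p ∈ (μ.restrict Q).support) (q : ℕ) :
    ∃ w : Fin d → ℤ, μ (cell q w) ≠ 0 ∧ (cell q w ∩ Q).Nonempty ∧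
      ∀ i, |gridIndex q p i - w i| ≤ 1 := by
  let U : Set (Space d) := {y | ∀ i, |gridIndex q p i - gridIndex q y i| ≤ 1}
  have hU : 0 < μ.restrict Q U :=
    (Measure.mem_support_iff_forall p).1 hp U (eventually_abs_gridIndex_sub_le_one q p)
  obtain ⟨w, hw⟩ : ∃ w : Fin d → ℤ, μ.restrict Q (U ∩ cell q w) ≠ 0 := by
    by_contra! hnull
    refine hU.ne' (measure_mono_null (fun y hy => ?_) (measure_iUnion_null hnull))
    exact Set.mem_iUnion.2 ⟨gridIndex q y, hy, mem_cell_gridIndex q y⟩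
  have hwQ : μ (cell q w ∩ Q) ≠ 0 := by
    rw [← Measure.restrict_apply (measurableSet_cell q w)]
    exact fun h => hw (measure_mono_null Set.inter_subset_right h)
  obtain ⟨y, hyU, rfl⟩ := nonempty_of_measure_ne_zero hw
  exact ⟨_, fun h => hwQ (measure_mono_null Set.inter_subset_left h),
    nonempty_of_measure_ne_zero hwQ, hyU⟩

theorem abs_index_le_of_inter_cube {w : Fin d → ℤ} {s : ℝ}
    (h : (cell q w ∩ cube s (0 : Space d)).Nonempty) {m : ℤ} (hm : q * (s / 2) + 1 ≤ m)
    (i : Fin d) : |w i| ≤ m := by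
  obtain ⟨y, hyw, hys⟩ := h
  have hyi := mem_cell_iff.1 hyw i
  have hsi : |y i| ≤ s / 2 := by
    rw [← sub_zero (y i)]
    exact hys i
  have hq : (0 : ℝ) ≤ q := q.cast_nonneg
  rw [abs_le] at hsi
  have hm' : |(w i : ℝ)| ≤ m := by
    rw [abs_le]
    constructor <;> nlinarith
  exact_mod_cast hm'

theorem cell_subset_cube (hq : 0 < q) {w : Fin d → ℤ} {x : Space d} {s m : ℝ}
    (h : ∀ i, |(w i : ℝ) - q * x i| ≤ m) (hm : m + 1 ≤ q * (s / 2)) :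
    cell q w ⊆ cube s x := by
  intro y hy i
  have : (0 : ℝ) < q := by exact_mod_cast hq
  have hyi := mem_cell_iff.1 hy i
  have hwi := abs_le.1 (h i)
  rw [abs_le]
  constructor <;> nlinarith

end Cells

section GoodWindows

variable {d q b : ℕ}

/-- The indices of the cells in the window of a site: a cube of radius `11 * b`, whose inner cube
of radius `b` and middle cube of radius `4 * b` enter the definition of a good pattern. -/
abbrev Window (d b : ℕ) : Type :=
  ↥(Finset.Icc (fun _ : Fin d => -(11 * b : ℤ)) (fun _ => (11 * b : ℤ)))

theorem mem_window {v : Fin d → ℤ} :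
    v ∈ Finset.Icc (fun _ : Fin d => -(11 * b : ℤ)) (fun _ => (11 * b : ℤ)) ↔
      ∀ i, |v i| ≤ 11 * b := by
  simp only [Finset.mem_Icc, Pi.le_def, abs_le, forall_and]

/-- The graph on a set `O` of cells of a window that joins two cells at sup-distance at most `3`;
points of two such cells are neighbours in the Gilbert graph once the cells are small. -/
def patternGraph (O : Set (Window d b)) : SimpleGraph O where
  Adj v w := v ≠ w ∧ ∀ i, |v.1.1 i - w.1.1 i| ≤ 3
  symm := ⟨fun v w h => ⟨h.1.symm, fun i => by rw [abs_sub_comm]; exact h.2 i⟩⟩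
  loopless := ⟨fun _ h => h.1 rfl⟩

/-- A set `O` of cells of a window is a good pattern if it meets the inner cube and if all its
cells in the middle cube are connected within `O`. -/
def GoodPattern (O : Set (Window d b)) : Prop :=
  (∃ v ∈ O, ∀ i, |v.1 i| ≤ b) ∧
    ∀ v w : O, (∀ i, |v.1.1 i| ≤ 4 * b) → (∀ i, |w.1.1 i| ≤ 4 * b) → (patternGraph O).Reachable v w

/-- The window is good for the masses `a` of the intensity measure and `m` of the point process if
the charged cells form a good pattern and are all occupied. -/
def GoodWindow {M : Type*} [Zero M] (a : Window d b → ℝ≥0∞) (m : Window d b → M) : Prop :=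
  GoodPattern (Function.support a) ∧ Function.support a ⊆ Function.support m

/-- The embedding of `ℤ²` as a coordinate plane of `ℤ^d`. -/
def planar (d : ℕ) (z : ℤ × ℤ) (i : Fin d) : ℤ :=
  if i.val = 0 then z.1 else if i.val = 1 then z.2 else 0

/-- The index in the grid of the cell `v` of the window of the site `z`; the windows of adjacent
sites are shifted by `3 * b` cells. -/
def cellIndex (b : ℕ) (z : ℤ × ℤ) (v : Fin d → ℤ) (i : Fin d) : ℤ :=
  v i + 3 * b * planar d z i

/-- The masses under `μ` of the cells in the window of the site `z`. -/
def windowMass (q b : ℕ) (z : ℤ × ℤ) (μ : Measure (Space d)) (v : Window d b) : ℝ≥0∞ :=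
  μ (cell q (cellIndex b z v.1))

/-- The sites whose windows are good for the intensity measure `μ` and the configuration `ξ`. -/
def goodSites (q b : ℕ) (μ ξ : Measure (Space d)) : Set (ℤ × ℤ) :=
  {z | GoodWindow (windowMass q b z μ) (windowMass q b z ξ)}

theorem windowMass_zero_site (μ : Measure (Space d)) (v : Window d b) :
    windowMass q b 0 μ v = μ (cell q v.1) := by
  have h : cellIndex b 0 v.1 = v.1 := funext fun i => by simp [cellIndex, planar]
  rw [windowMass, h]

theorem patternGraph_reachable_of_abs_sub_le {O : Set (Window d b)} {v w : O}
    (h : ∀ i, |v.1.1 i - w.1.1 i| ≤ 3) : (patternGraph O).Reachable v w := by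
  by_cases hvw : v = w
  · rw [hvw]
  · exact SimpleGraph.Adj.reachable ⟨hvw, h⟩

theorem patternGraph_reachable_of_isPreconnected {O : Set (Window d b)} {C : Set (Space d)}
    (hC : IsPreconnected C)
    (hO : ∀ p ∈ C, ∃ v : O, ∀ i, |gridIndex q p i - v.1.1 i| ≤ 1) {p p' : Space d} (hp : p ∈ C)
    (hp' : p' ∈ C) {v w : O} (hv : ∀ i, |gridIndex q p i - v.1.1 i| ≤ 1)
    (hw : ∀ i, |gridIndex q p' i - w.1.1 i| ≤ 1) : (patternGraph O).Reachable v w := by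
  let Joined (x y : Space d) : Prop := ∀ v w : O, (∀ i, |gridIndex q x i - v.1.1 i| ≤ 1) →
    (∀ i, |gridIndex q y i - w.1.1 i| ≤ 1) → (patternGraph O).Reachable v w
  suffices h : Joined p p' from h v w hv hw
  refine hC.induction₂' Joined (fun x _ => ?_) (fun x y z _ hy _ hxy hyz v w hv hw => ?_) hp hp'
  · filter_upwards [mem_nhdsWithin_of_mem_nhds (eventually_abs_gridIndex_sub_le_one q x)]
      with y hxy
    constructor <;>
    · intro v w hv hw
      refine patternGraph_reachable_of_abs_sub_le fun i => ?_
      have := abs_le.1 (hv i)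
      have := abs_le.1 (hw i)
      have := abs_le.1 (hxy i)
      rw [abs_le]
      omega
  · obtain ⟨u, hu⟩ := hO y hy
    exact (hxy v u hv hu).trans (hyz u w hu hw)

theorem exists_mem_support_windowMass {μ : Measure (Space d)} {s : ℝ} {p : Space d}
    (hp : p ∈ (μ.restrict (cube s 0)).support) {m : ℤ} (hm : q * (s / 2) + 1 ≤ m)
    (hmb : m ≤ 11 * b) :
    ∃ v : Function.support (windowMass (b := b) q 0 μ),
      (∀ i, |gridIndex q p i - v.1.1 i| ≤ 1) ∧ ∀ i, |v.1.1 i| ≤ m := by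
  obtain ⟨w, hw, hwQ, hpw⟩ := exists_cell_of_mem_support hp q
  have hwm := abs_index_le_of_inter_cube hwQ hm
  refine ⟨⟨⟨w, mem_window.2 fun i => (hwm i).trans hmb⟩, ?_⟩, hpw, hwm⟩
  rw [Function.mem_support, windowMass_zero_site]
  exact hw

theorem exists_mem_support_of_windowMass_ne_zero (hq : 0 < q) {μ : Measure (Space d)} {s : ℝ}
    {v : Window d b} (hv : windowMass q b 0 μ v ≠ 0) {m : ℤ} (hvm : ∀ i, |v.1 i| ≤ m)
    (hm : m + 1 ≤ q * (s / 2)) :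
    ∃ p ∈ (μ.restrict (cube s 0)).support, gridIndex q p = v.1 := by
  have hsub : cell q v.1 ⊆ cube s (0 : Space d) := by
    refine cell_subset_cube hq (m := m) (fun i => ?_) hm
    rw [PiLp.zero_apply, mul_zero, sub_zero]
    exact_mod_cast hvm i
  have hpos : 0 < μ.restrict (cube s 0) (cell q v.1) := by
    rw [Measure.restrict_apply (measurableSet_cell _ _), Set.inter_eq_left.2 hsub,
      pos_iff_ne_zero, ← windowMass_zero_site]
    exact hv
  obtain ⟨p, hpv, hp⟩ := Measure.nonempty_inter_support_of_pos hpos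
  exact ⟨p, hp, hpv⟩

theorem goodPattern_of_support {k : ℕ} (hq : 0 < q) (hk : 2 ≤ k) {μ : Measure (Space d)}
    (hne : (μ.restrict (cube k 0)).support.Nonempty)
    (hconn : ∃ x ∈ (μ.restrict (cube (20 * k) 0)).support,
      (μ.restrict (cube (10 * k) 0)).support ⊆
        connectedComponentIn (μ.restrict (cube (20 * k) 0)).support x) :
    GoodPattern (Function.support (windowMass q (q * k) 0 μ)) := by
  have hqk : (2 : ℝ) ≤ q * k := by
    exact_mod_cast hk.trans (Nat.le_mul_of_pos_left k hq)
  constructor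
  · obtain ⟨p, hp⟩ := hne
    obtain ⟨v, -, hv⟩ := exists_mem_support_windowMass (q := q) (b := q * k) hp
      (m := (q * k : ℕ)) (by push_cast; linarith) (by omega)
    exact ⟨v.1, v.2, hv⟩
  · obtain ⟨x, -, hsub⟩ := hconn
    have hcover (p : Space d)
        (hp : p ∈ connectedComponentIn (μ.restrict (cube (20 * k) 0)).support x) :
        ∃ v : Function.support (windowMass (b := q * k) q 0 μ),
          ∀ i, |gridIndex q p i - v.1.1 i| ≤ 1 := by
      obtain ⟨v, hv, -⟩ := exists_mem_support_windowMass (q := q) (b := q * k)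
        (connectedComponentIn_subset _ _ hp) (m := 11 * (q * k : ℕ)) (by push_cast; linarith)
        le_rfl
      exact ⟨v, hv⟩
    have hpoint (v : Function.support (windowMass (b := q * k) q 0 μ))
        (hv : ∀ i, |v.1.1 i| ≤ 4 * (q * k : ℕ)) :
        ∃ p ∈ connectedComponentIn (μ.restrict (cube (20 * k) 0)).support x,
          ∀ i, |gridIndex q p i - v.1.1 i| ≤ 1 := by
      obtain ⟨p, hp, hpv⟩ := exists_mem_support_of_windowMass_ne_zero hq (s := 10 * k) v.2 hv
        (by push_cast; linarith)
      exact ⟨p, hsub hp, fun i => by rw [hpv, sub_self, abs_zero]; exact zero_le_one⟩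
    intro v w hv hw
    obtain ⟨p, hp, hpv⟩ := hpoint v hv
    obtain ⟨p', hp', hpw⟩ := hpoint w hw
    exact patternGraph_reachable_of_isPreconnected isPreconnected_connectedComponentIn hcover
      hp hp' hpv hpw

theorem abs_planar_sub_le {z z' : ℤ × ℤ} (h : kingGraph.Adj z z') (i : Fin d) :
    |planar d z' i - planar d z i| ≤ 1 := by
  rw [abs_sub_comm]
  unfold planar
  split_ifs
  · exact h.2.1
  · exact h.2.2
  · simp

theorem eq_of_abs_planar_sub_lt (hd : 2 ≤ d) {z z' : ℤ × ℤ}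
    (h : ∀ i, |planar d z i - planar d z' i| < 1) : z = z' := by
  have h0 := h ⟨0, by omega⟩
  have h1 := h ⟨1, by omega⟩
  simp only [planar, if_true, one_ne_zero, if_false, Int.abs_lt_one_iff, sub_eq_zero] at h0 h1
  exact Prod.ext h0 h1

end GoodWindows

section Renormalization

variable {d q b : ℕ}

theorem reachable_of_adj_reachable {V W : Type*} {G : SimpleGraph V} {H : SimpleGraph W}
    {f : V → W} (hf : ∀ u v, G.Adj u v → H.Reachable (f u) (f v)) {u v : V}
    (h : G.Reachable u v) : H.Reachable (f u) (f v) := by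
  simp only [SimpleGraph.reachable_iff_reflTransGen] at hf h ⊢
  exact h.lift' f hf

theorem exists_infinite_component_of_injective {V W : Type*} {G : SimpleGraph V}
    {H : SimpleGraph W} {f : V → W} (hinj : Function.Injective f)
    (hf : ∀ u v, G.Adj u v → H.Reachable (f u) (f v))
    (hG : ∃ C : G.ConnectedComponent, C.supp.Infinite) :
    ∃ C : H.ConnectedComponent, C.supp.Infinite := by
  obtain ⟨C, hC⟩ := hG
  obtain ⟨u, hu⟩ := hC.nonempty
  refine ⟨H.connectedComponentMk (f u), (hC.image hinj.injOn).mono ?_⟩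
  rintro _ ⟨v, hv, rfl⟩
  exact SimpleGraph.ConnectedComponent.sound
    (reachable_of_adj_reachable hf (SimpleGraph.ConnectedComponent.exact (hv.trans hu.symm)))

variable {r : ℝ} {μ ξ : Measure (Space d)}

theorem gilbertGraph_reachable_of_mem_cell (hq : 0 < q) (hr : 0 < r) (hqr : 4 * d < r * q)
    {v w : Fin d → ℤ} (h : ∀ i, |v i - w i| ≤ 3) {x y : points ξ} (hx : x.1 ∈ cell q v)
    (hy : y.1 ∈ cell q w) : (gilbertGraph r ξ).Reachable x y := by
  by_cases hxy : x = y
  · rw [hxy]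
  · exact SimpleGraph.Adj.reachable ⟨hxy, dist_lt_of_mem_cell hq hr hqr h hx hy⟩

theorem exists_point_of_windowMass_ne_zero (hq : 0 < q) (hξ : IsCountingMeasure ξ) {z : ℤ × ℤ}
    {v : Window d b} (hv : windowMass q b z ξ v ≠ 0) :
    ∃ x : points ξ, x.1 ∈ cell q (cellIndex b z v.1) := by
  obtain ⟨x, hx, hxξ⟩ := hξ.exists_mem_points (measurableSet_cell _ _) (isBounded_cell hq _) hv
  exact ⟨⟨x, hxξ⟩, hx⟩

theorem gilbertGraph_reachable_of_patternGraph_reachable (hq : 0 < q) (hr : 0 < r)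
    (hqr : 4 * d < r * q) (hξ : IsCountingMeasure ξ) {z : ℤ × ℤ} {O : Set (Window d b)}
    (hO : O ⊆ Function.support (windowMass q b z ξ)) {v w : O}
    (h : (patternGraph O).Reachable v w) {x y : points ξ}
    (hx : x.1 ∈ cell q (cellIndex b z v.1.1)) (hy : y.1 ∈ cell q (cellIndex b z w.1.1)) :
    (gilbertGraph r ξ).Reachable x y := by
  have hindex {u u' : Fin d → ℤ} (h : ∀ i, |u i - u' i| ≤ 3) (i : Fin d) :
      |cellIndex b z u i - cellIndex b z u' i| ≤ 3 := by
    simpa only [cellIndex, add_sub_add_right_eq_sub] using h i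
  choose p hp using fun u : O => exists_point_of_windowMass_ne_zero hq hξ (hO u.2)
  have hpath : (gilbertGraph r ξ).Reachable (p v) (p w) :=
    reachable_of_adj_reachable (G := patternGraph O) (f := p) (fun u u' huu' =>
      gilbertGraph_reachable_of_mem_cell hq hr hqr (hindex huu'.2) (hp u) (hp u')) h
  exact (gilbertGraph_reachable_of_mem_cell hq hr hqr (by simp) hx (hp v)).trans
    (hpath.trans (gilbertGraph_reachable_of_mem_cell hq hr hqr (by simp) (hp w) hy))

theorem gilbertGraph_reachable_of_adj (hq : 0 < q) (hr : 0 < r) (hqr : 4 * d < r * q)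
    (hξ : IsCountingMeasure ξ) {z z' : ℤ × ℤ} (hz : z ∈ goodSites q b μ ξ)
    (hzz' : kingGraph.Adj z z') {v v' : Window d b} (hv : windowMass q b z μ v ≠ 0)
    (hv' : windowMass q b z' μ v' ≠ 0) (hvb : ∀ i, |v.1 i| ≤ b) (hvb' : ∀ i, |v'.1 i| ≤ b)
    {x y : points ξ} (hx : x.1 ∈ cell q (cellIndex b z v.1))
    (hy : y.1 ∈ cell q (cellIndex b z' v'.1)) : (gilbertGraph r ξ).Reachable x y := by
  -- The cell `v'` of the window of `z'` lies in the middle cube of the window of `z`.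
  let w (i : Fin d) : ℤ := v'.1 i + 3 * b * (planar d z' i - planar d z i)
  have hwb (i : Fin d) : |w i| ≤ 4 * b := by
    have := abs_le.1 (hvb' i)
    have := abs_le.1 (abs_planar_sub_le hzz' i)
    rw [abs_le]
    constructor <;> simp only [w] <;> nlinarith
  have hindex : cellIndex b z w = cellIndex b z' v'.1 := funext fun i => by
    simp only [cellIndex, w]
    ring
  have hwwin : w ∈ Finset.Icc (fun _ : Fin d => -(11 * b : ℤ)) (fun _ => (11 * b : ℤ)) :=
    mem_window.2 fun i => (hwb i).trans (by omega)
  have hw : windowMass q b z μ ⟨w, hwwin⟩ ≠ 0 := by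
    rwa [windowMass, hindex]
  have hreach := hz.1.2 ⟨v, hv⟩ ⟨⟨w, hwwin⟩, hw⟩ (fun i => (hvb i).trans (by omega)) hwb
  exact gilbertGraph_reachable_of_patternGraph_reachable hq hr hqr hξ hz.2 hreach hx
    (hindex.symm ▸ hy)

theorem eq_of_cellIndex_eq (hd : 2 ≤ d) (hb : 0 < b) {z z' : ℤ × ℤ} {v v' : Window d b}
    (hv : ∀ i, |v.1 i| ≤ b) (hv' : ∀ i, |v'.1 i| ≤ b)
    (h : cellIndex b z v.1 = cellIndex b z' v'.1) : z = z' := by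
  refine eq_of_abs_planar_sub_lt hd fun i => ?_
  have hi : v.1 i + 3 * b * planar d z i = v'.1 i + 3 * b * planar d z' i := congrFun h i
  have := abs_le.1 (hv i)
  have := abs_le.1 (hv' i)
  have : (0 : ℤ) < b := by exact_mod_cast hb
  rw [abs_lt]
  constructor <;> nlinarith

theorem percolates_of_sitePercolates (hd : 2 ≤ d) (hq : 0 < q) (hb : 0 < b) (hr : 0 < r)
    (hqr : 4 * d < r * q) (hξ : IsCountingMeasure ξ) (h : SitePercolates (goodSites q b μ ξ)) :
    Percolates r ξ := by
  choose v hv hvb using fun z : goodSites q b μ ξ => z.2.1.1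
  choose x hx using fun z : goodSites q b μ ξ =>
    exists_point_of_windowMass_ne_zero hq hξ (z.2.2 (hv z))
  refine exists_infinite_component_of_injective (f := x) (fun z z' hzz' => ?_)
    (fun z z' hzz' => ?_) h
  · have hgrid : gridIndex q (x z).1 = gridIndex q (x z').1 := by rw [hzz']
    have hindex : cellIndex b z.1 (v z).1 = cellIndex b z'.1 (v z').1 :=
      (hx z).symm.trans (hgrid.trans (hx z'))
    exact Subtype.ext (eq_of_cellIndex_eq hd hb (hvb z) (hvb z') hindex)
  · exact gilbertGraph_reachable_of_adj hq hr hqr hξ z.2 (squareLattice_le_kingGraph hzz')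
      (hv z) (hv z') (hvb z) (hvb z') (hx z) (hx z')

end Renormalization

section Conditioning

/-- The law of independent Poisson counts with parameters `l * a v`. -/
def poissonCounts {κ : Type*} [Fintype κ] (l : ℝ≥0) (a : κ → ℝ≥0∞) : Measure (κ → ℕ) :=
  Measure.pi fun v => poissonMeasure (l * (a v).toNNReal)

instance {κ : Type*} [Fintype κ] (l : ℝ≥0) (a : κ → ℝ≥0∞) :
    IsProbabilityMeasure (poissonCounts l a) :=
  inferInstanceAs (IsProbabilityMeasure (Measure.pi _))

theorem measurable_poissonCounts_singleton {κ : Type*} [Fintype κ] (l : ℝ≥0) (m : κ → ℕ) :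
    Measurable fun a : κ → ℝ≥0∞ => poissonCounts l a {m} := by
  simp only [poissonCounts, Measure.pi_singleton, poissonMeasure_singleton]
  fun_prop

variable {d : ℕ} {Ω : Type*} [MeasurableSpace Ω] {P : Measure Ω} {Λ X : Ω → Measure (Space d)}
  {l : ℝ≥0}

theorem IsCoxProcess.measure_inter_counts_eq (hX : IsCoxProcess P Λ l X) {κ : Type*} [Fintype κ]
    {B : κ → Set (Space d)} (hB : ∀ i, MeasurableSet (B i)) (hBb : ∀ i, Bornology.IsBounded (B i))
    (hdisj : Pairwise (Function.onFun Disjoint B)) (m : κ → ℕ) {A : Set (Measure (Space d))}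
    (hA : MeasurableSet A) :
    P (Λ ⁻¹' A ∩ {ω | ∀ i, X ω (B i) = m i}) =
      ∫⁻ ω in Λ ⁻¹' A, ∏ i, poissonMeasure (l * (Λ ω (B i)).toNNReal) {m i} ∂P := by
  let e := (Fintype.equivFin κ).symm
  have hcounts : {ω | ∀ i, X ω (B i) = m i} = {ω | ∀ j, X ω (B (e j)) = m (e j)} :=
    Set.ext fun ω => e.forall_congr_right.symm
  rw [hcounts, hX.poisson _ (fun j => B (e j)) (fun j => hB _) (fun j => hBb _)
    (fun i j hij => hdisj (e.injective.ne hij)) (fun j => m (e j)) A hA]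
  exact lintegral_congr fun ω =>
    e.prod_comp fun i => poissonMeasure (l * (Λ ω (B i)).toNNReal) {m i}

theorem IsCoxProcess.measure_forall_counts_mem_le (hX : IsCoxProcess P Λ l X) (hΛ : Measurable Λ)
    {ι κ : Type*} [Fintype ι] [Fintype κ] {B : ι → κ → Set (Space d)}
    (hB : ∀ i k, MeasurableSet (B i k)) (hBb : ∀ i k, Bornology.IsBounded (B i k))
    (hdisj : Pairwise (Function.onFun Disjoint (Function.uncurry B)))
    {E : (κ → ℝ≥0∞) → Set (κ → ℕ)} (hE : ∀ m, MeasurableSet {a | m ∈ E a}) :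
    P {ω | ∀ i, ∃ m ∈ E fun k => Λ ω (B i k), ∀ k, X ω (B i k) = m k} ≤
      ∫⁻ ω, ∏ i, poissonCounts l (fun k => Λ ω (B i k)) (E fun k => Λ ω (B i k)) ∂P := by
  have hmass (i : ι) : Measurable fun (μ : Measure (Space d)) k => μ (B i k) :=
    measurable_pi_lambda _ fun k => Measure.measurable_coe (hB i k)
  let A (m : ι → κ → ℕ) : Set (Measure (Space d)) := {μ | ∀ i, m i ∈ E fun k => μ (B i k)}
  have hA (m : ι → κ → ℕ) : MeasurableSet (A m) := by
    have : A m = ⋂ i, (fun μ k => μ (B i k)) ⁻¹' {a | m i ∈ E a} := by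
      ext μ
      simp only [A, Set.mem_iInter, Set.mem_preimage, Set.mem_ofPred_eq]
    exact this ▸ MeasurableSet.iInter fun i => hmass i (hE (m i))
  let N (m : ι → κ → ℕ) : Set Ω := {ω | ∀ i k, X ω (B i k) = m i k}
  let ν (ω : Ω) : Measure (ι → κ → ℕ) := Measure.pi fun i => poissonCounts l fun k => Λ ω (B i k)
  have hν (m : ι → κ → ℕ) : Measurable fun ω => ν ω {m} := by
    simp only [ν, Measure.pi_singleton]
    exact Finset.measurable_prod _ fun i _ =>
      (measurable_poissonCounts_singleton l (m i)).comp ((hmass i).comp hΛ)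
  have hN (m : ι → κ → ℕ) : P (Λ ⁻¹' A m ∩ N m) = ∫⁻ ω in Λ ⁻¹' A m, ν ω {m} ∂P := by
    have h := hX.measure_inter_counts_eq (fun p => hB p.1 p.2) (fun p => hBb p.1 p.2) hdisj
      (Function.uncurry m) (hA m)
    simp only [Prod.forall, Function.uncurry_apply_pair, Fintype.prod_prod_type] at h
    simpa only [ν, poissonCounts, Measure.pi_singleton] using h
  calc P {ω | ∀ i, ∃ m ∈ E fun k => Λ ω (B i k), ∀ k, X ω (B i k) = m k}
      ≤ P (⋃ m, Λ ⁻¹' A m ∩ N m) := by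
        refine measure_mono fun ω hω => ?_
        choose m hmE hmX using hω
        exact Set.mem_iUnion.2 ⟨m, hmE, hmX⟩
    _ ≤ ∑' m, P (Λ ⁻¹' A m ∩ N m) := measure_iUnion_le _
    _ = ∑' m, ∫⁻ ω, (Λ ⁻¹' A m).indicator (fun ω => ν ω {m}) ω ∂P :=
        tsum_congr fun m => by rw [hN, lintegral_indicator (hΛ (hA m))]
    _ = ∫⁻ ω, ∑' m, {m | Λ ω ∈ A m}.indicator (fun m => ν ω {m}) m ∂P :=
        (lintegral_tsum fun m => ((hν m).indicator (hΛ (hA m))).aemeasurable).symm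
    _ = ∫⁻ ω, ∏ i, poissonCounts l (fun k => Λ ω (B i k)) (E fun k => Λ ω (B i k)) ∂P := by
        refine lintegral_congr fun ω => ?_
        rw [Measure.tsum_indicator_apply_singleton _ _ MeasurableSet.of_discrete, ← Measure.pi_pi]
        congr 1
        ext m
        simp only [A, Set.mem_ofPred_eq, Set.mem_univ_pi]

end Conditioning

section GoodProb

variable {d b : ℕ}

/-- The conditional probability that a window is good, given the masses `a` of its cells. It takes
values in `ℝ≥0`, as do the functionals in the definition of stabilization. -/
def goodProb (l : ℝ≥0) (a : Window d b → ℝ≥0∞) : ℝ≥0 :=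
  (poissonCounts l a {m | GoodWindow a m}).toNNReal

theorem coe_goodProb (l : ℝ≥0) (a : Window d b → ℝ≥0∞) :
    (goodProb l a : ℝ≥0∞) = poissonCounts l a {m | GoodWindow a m} :=
  ENNReal.coe_toNNReal (measure_ne_top _ _)

theorem goodProb_le_one (l : ℝ≥0) (a : Window d b → ℝ≥0∞) : goodProb l a ≤ 1 := by
  rw [← ENNReal.coe_le_coe, coe_goodProb]
  exact prob_le_one

theorem goodProb_zero (l : ℝ≥0) : goodProb l (0 : Window d b → ℝ≥0∞) = 0 := by
  have h : {m : Window d b → ℕ | GoodWindow 0 m} = ∅ :=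
    Set.eq_empty_of_forall_notMem fun m ⟨⟨⟨v, hv, _⟩, _⟩, _⟩ => hv rfl
  rw [goodProb, h, measure_empty, ENNReal.toNNReal_zero]

theorem poissonCounts_not_goodWindow (l : ℝ≥0) (a : Window d b → ℝ≥0∞) :
    poissonCounts l a {m | ¬GoodWindow a m} = 1 - goodProb l a := by
  rw [coe_goodProb, ← prob_compl_eq_one_sub MeasurableSet.of_discrete]
  rfl

theorem measurableSet_support_mem {κ : Type*} [Finite κ] (S : Set (Set κ)) :
    MeasurableSet {a : κ → ℝ≥0∞ | Function.support a ∈ S} := by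
  have hsupport : Measurable fun (a : κ → ℝ≥0∞) (v : κ) => a v ≠ 0 :=
    measurable_pi_lambda _ fun v => measurableSet_setOfPred.1
      (measurableSet_eq_fun (measurable_pi_apply v) measurable_const).compl
  exact hsupport (MeasurableSet.of_discrete (s := {p : κ → Prop | {v | p v} ∈ S}))

theorem measurableSet_goodWindow {M : Type*} [Zero M] (m : Window d b → M) :
    MeasurableSet {a : Window d b → ℝ≥0∞ | GoodWindow a m} :=
  measurableSet_support_mem {O | GoodPattern O ∧ O ⊆ Function.support m}

theorem measurable_goodProb (l : ℝ≥0) :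
    Measurable (goodProb l : (Window d b → ℝ≥0∞) → ℝ≥0) := by
  refine Measurable.ennreal_toNNReal ?_
  have hsum (a : Window d b → ℝ≥0∞) : poissonCounts l a {m | GoodWindow a m} =
      ∑' m, {a | GoodWindow a m}.indicator (fun a => poissonCounts l a {m}) a :=
    (Measure.tsum_indicator_apply_singleton _ _ MeasurableSet.of_discrete).symm
  simp only [hsum]
  exact Measurable.tsum fun m =>
    (measurable_poissonCounts_singleton l m).indicator (measurableSet_goodWindow m)

theorem tendsto_poissonMeasure_ne_zero {t : ℝ≥0} (ht : 0 < t) :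
    Tendsto (fun l : ℕ => poissonMeasure (l * t) {n | n ≠ 0}) atTop (𝓝 1) := by
  have hzero : Tendsto (fun l : ℕ => poissonMeasure (l * t) {0}) atTop (𝓝 0) := by
    have hexp : Tendsto (fun l : ℕ => Real.exp (-(l * t))) atTop (𝓝 0) :=
      Real.tendsto_exp_neg_atTop_nhds_zero.comp
        (tendsto_natCast_atTop_atTop.atTop_mul_const (by exact_mod_cast ht))
    simpa [poissonMeasure_singleton] using ENNReal.tendsto_ofReal hexp
  have hcompl := ENNReal.Tendsto.sub tendsto_const_nhds hzero (.inl ENNReal.one_ne_top)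
  rw [tsub_zero] at hcompl
  exact hcompl.congr fun l => (prob_compl_eq_one_sub (measurableSet_singleton 0)).symm

theorem tendsto_goodProb {a : Window d b → ℝ≥0∞} (ha : ∀ v, a v ≠ ∞)
    (hgood : GoodPattern (Function.support a)) :
    Tendsto (fun l : ℕ => goodProb l a) atTop (𝓝 1) := by
  rw [← ENNReal.tendsto_coe, ENNReal.coe_one]
  have hprod (l : ℕ) : (goodProb l a : ℝ≥0∞) =
      ∏ v, poissonMeasure (l * (a v).toNNReal) {n | a v ≠ 0 → n ≠ 0} := by
    rw [coe_goodProb, poissonCounts, ← Measure.pi_pi]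
    congr 1
    ext m
    simp only [GoodWindow, hgood, true_and, Set.mem_univ_pi, Set.mem_ofPred_eq]
    rfl
  simp only [hprod]
  rw [← Finset.prod_const_one (s := (Finset.univ : Finset (Window d b)))]
  refine ENNReal.tendsto_finsetProd_of_ne_top _ (fun v _ => ?_) fun _ _ => ENNReal.one_ne_top
  by_cases hv : a v = 0
  · simp [hv]
  · simpa [hv] using tendsto_poissonMeasure_ne_zero (ENNReal.toNNReal_pos hv (ha v))

theorem measurable_windowMass (q b : ℕ) (z : ℤ × ℤ) :
    Measurable (windowMass q b z : Measure (Space d) → Window d b → ℝ≥0∞) :=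
  measurable_pi_lambda _ fun _ => Measure.measurable_coe (measurableSet_cell _ _)

theorem IsCoxProcess.measure_forall_notMem_goodSites_le {Ω : Type*} [MeasurableSpace Ω]
    {P : Measure Ω} {Λ X : Ω → Measure (Space d)} {l : ℝ≥0} (hX : IsCoxProcess P Λ l X)
    (hΛ : Measurable Λ) {q : ℕ} (hq : 0 < q) {T : Finset (ℤ × ℤ)}
    (hT : Function.Injective fun p : T × Window d b => cellIndex b p.1.1 p.2.1) :
    P {ω | ∀ z ∈ T, z ∉ goodSites q b (Λ ω) (X ω)} ≤
      ∫⁻ ω, ∏ z : T, (1 - (goodProb l (windowMass q b z (Λ ω)) : ℝ≥0∞)) ∂P := by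
  have hbound := hX.measure_forall_counts_mem_le hΛ
    (B := fun (z : T) (v : Window d b) => cell q (cellIndex b z v.1))
    (fun _ _ => measurableSet_cell _ _) (fun _ _ => isBounded_cell hq _)
    (fun _ _ h => disjoint_cell (hT.ne h)) (E := fun a => {m | ¬GoodWindow a m})
    (fun m => (measurableSet_goodWindow m).compl)
  simp only [poissonCounts_not_goodWindow] at hbound
  refine (measure_mono_ae ?_).trans hbound
  filter_upwards [hX.counting] with ω hω hbad z
  choose m hm using fun v : Window d b =>
    hω _ (measurableSet_cell q (cellIndex b z v.1)) (isBounded_cell hq _)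
  refine ⟨m, fun hz => hbad z z.2 ⟨hz.1, hz.2.trans fun v hv => ?_⟩, hm⟩
  rw [Function.mem_support, windowMass, hm]
  exact Nat.cast_ne_zero.2 hv

end GoodProb

section Stationarity

variable {d q k : ℕ}

/-- The points of the lattice `s ℤ^d`. -/
def latticePoint (s : ℕ) (c : Fin d → ℤ) : Space d :=
  WithLp.toLp 2 fun i => s * (c i : ℝ)

/-- The centre of the window of the site `z` for cells of side length `1 / q` and windows with
`b = q * k`. -/
def siteCenter (d k : ℕ) (z : ℤ × ℤ) : Space d :=
  latticePoint (3 * k) (planar d z)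

theorem latticePoint_mem_rationalPoints (s : ℕ) (c : Fin d → ℤ) :
    latticePoint s c ∈ rationalPoints d :=
  fun i => ⟨s * c i, by simp [latticePoint]⟩

theorem countable_rationalPoints (d : ℕ) : (rationalPoints d).Countable := by
  refine (Set.countable_range fun c : Fin d → ℚ =>
    (WithLp.toLp 2 fun i => (c i : ℝ) : Space d)).mono fun y hy => ?_
  choose c hc using hy
  exact ⟨c, PiLp.ext fun i => (hc i).symm⟩

theorem add_mem_rationalPoints {x y : Space d} (hy : y ∈ rationalPoints d)
    (hx : x ∈ rationalPoints d) : y + x ∈ rationalPoints d := fun i => by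
  obtain ⟨a, ha⟩ := hy i
  obtain ⟨c, hc⟩ := hx i
  exact ⟨a + c, by rw [PiLp.add_apply, ha, hc, Rat.cast_add]⟩

theorem neg_mem_rationalPoints {x : Space d} (hx : x ∈ rationalPoints d) :
    -x ∈ rationalPoints d := fun i => by
  obtain ⟨a, ha⟩ := hx i
  exact ⟨-a, by rw [PiLp.neg_apply, ha, Rat.cast_neg]⟩

theorem image_add_cube_inter_rationalPoints (s : ℝ) {x : Space d} (hx : x ∈ rationalPoints d) :
    (· + x) '' (cube s 0 ∩ rationalPoints d) = cube s x ∩ rationalPoints d := by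
  ext y
  have hcube : y + -x ∈ cube s 0 ↔ y ∈ cube s x := by
    simp only [cube, Set.mem_ofPred_eq, ← sub_eq_add_neg, PiLp.sub_apply, PiLp.zero_apply,
      sub_zero]
  have hrational : y + -x ∈ rationalPoints d ↔ y ∈ rationalPoints d :=
    ⟨fun h => neg_add_cancel_right y x ▸ add_mem_rationalPoints h hx,
      fun h => add_mem_rationalPoints h (neg_mem_rationalPoints hx)⟩
  rw [Set.image_add_right, Set.mem_preimage, Set.mem_inter_iff, Set.mem_inter_iff, hcube,
    hrational]

theorem supRadius_eq_supRadius_translate {Ω : Type*} (R : Space d → Ω → ℝ≥0∞) (s : ℝ)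
    {x : Space d} (hx : x ∈ rationalPoints d) (ω : Ω) :
    supRadius R s x ω =
      supRadius (fun y (ρ : Space d → ℝ≥0∞) => ρ y) s 0 (fun y => R (y + x) ω) := by
  rw [supRadius, ← image_add_cube_inter_rationalPoints s hx, iSup_image, supRadius]

theorem measurable_supRadius {Ω : Type*} [MeasurableSpace Ω] {R : Space d → Ω → ℝ≥0∞}
    (hR : ∀ y, Measurable (R y)) (s : ℝ) (x : Space d) : Measurable (supRadius R s x) :=
  Measurable.biSup _ ((countable_rationalPoints d).mono Set.inter_subset_right) fun y _ => hR y

theorem shift_siteCenter_cell (q k : ℕ) (z : ℤ × ℤ) (μ : Measure (Space d)) (v : Fin d → ℤ) :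
    shift (siteCenter d k z) μ (cell q v) = μ (cell q (cellIndex (q * k) z v)) := by
  rw [shift, Measure.map_apply (by fun_prop) (measurableSet_cell _ _)]
  congr 1
  ext y
  simp only [Set.mem_preimage, mem_cell_iff, cellIndex, siteCenter, latticePoint, PiLp.sub_apply]
  refine forall_congr' fun i => ?_
  push_cast
  constructor <;> rintro ⟨hlower, hupper⟩ <;> constructor <;> linarith

theorem windowMass_shift_siteCenter (q k : ℕ) (z : ℤ × ℤ) (μ : Measure (Space d)) :
    windowMass q (q * k) 0 (shift (siteCenter d k z) μ) = windowMass q (q * k) z μ :=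
  funext fun v => by rw [windowMass_zero_site, shift_siteCenter_cell, windowMass]

variable {Ω : Type*} [MeasurableSpace Ω] {P : Measure Ω} {Λ : Ω → Measure (Space d)}
  {R : Space d → Ω → ℝ≥0∞}

theorem IsStabilizationField.measurableSet_not_supRadius_lt (hR : IsStabilizationField P Λ R)
    (s : ℝ) (x : Space d) (t : ℝ≥0∞) : MeasurableSet {ω | ¬supRadius R s x ω < t} :=
  (measurableSet_lt (measurable_supRadius hR.measurable s x) measurable_const).compl

theorem IsStabilizationField.measure_not_supRadius_lt (hR : IsStabilizationField P Λ R) (s : ℝ)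
    {x : Space d} (hx : x ∈ rationalPoints d) (t : ℝ≥0∞) :
    P {ω | ¬supRadius R s x ω < t} = P {ω | ¬supRadius R s 0 ω < t} := by
  have hsup : Measurable (supRadius (fun y (ρ : Space d → ℝ≥0∞) => ρ y) s 0) :=
    measurable_supRadius measurable_pi_apply s 0
  have h := ((hR.jointly_stationary x).comp (hsup.comp measurable_snd)).measure_mem_eq
    (measurableSet_Iio (a := t)).compl
  simp only [supRadius_eq_supRadius_translate R s hx]
  exact h

theorem IsStationaryRandomMeasure.ae_unitCube_ne_top (hΛ : IsStationaryRandomMeasure P Λ)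
    (x : Space d) : ∀ᵐ ω ∂P, Λ ω {y | ∀ i, 0 ≤ y i - x i ∧ y i - x i ≤ 1} ≠ ∞ := by
  let U : Set (Space d) := {y | ∀ i, 0 ≤ y i ∧ y i ≤ 1}
  have hU : MeasurableSet U := by
    have : U = ⋂ i, ({y : Space d | 0 ≤ y i} ∩ {y | y i ≤ 1}) := by
      ext y
      simp only [U, Set.mem_iInter, Set.mem_inter_iff, Set.mem_ofPred_eq]
    exact this ▸ MeasurableSet.iInter fun i =>
      (measurableSet_le measurable_const (by fun_prop)).inter
        (measurableSet_le (by fun_prop) measurable_const)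
  have hsub : Measurable fun y : Space d => y - x := by fun_prop
  have hintegral : ∫⁻ ω, Λ ω ((fun y => y - x) ⁻¹' U) ∂P = 1 := by
    have hshift := ((hΛ.stationary x).comp (Measure.measurable_coe hU)).lintegral_eq
    exact (lintegral_congr fun ω => (Measure.map_apply hsub hU).symm).trans
      (hshift.trans hΛ.intensity)
  have hmeas : Measurable fun ω => Λ ω ((fun y => y - x) ⁻¹' U) :=
    (Measure.measurable_coe (hsub hU)).comp hΛ.measurable
  filter_upwards [ae_lt_top hmeas (hintegral ▸ ENNReal.one_ne_top)] with ω hω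
  exact hω.ne

theorem IsStationaryRandomMeasure.ae_cell_ne_top (hΛ : IsStationaryRandomMeasure P Λ)
    (hq : 0 < q) (w : Fin d → ℤ) : ∀ᵐ ω ∂P, Λ ω (cell q w) ≠ ∞ := by
  have hq' : (0 : ℝ) < q := by exact_mod_cast hq
  have hq1 : (1 : ℝ) ≤ q := by exact_mod_cast hq
  filter_upwards [hΛ.ae_unitCube_ne_top (WithLp.toLp 2 fun i => (w i : ℝ) / q)] with ω hω
  refine ne_top_of_le_ne_top hω (measure_mono fun y hy i => ?_)
  have hyi := mem_cell_iff.1 hy i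
  constructor
  · rw [sub_nonneg, div_le_iff₀' hq']
    exact hyi.1
  · rw [sub_le_iff_le_add', ← sub_le_iff_le_add, le_div_iff₀' hq']
    linarith

theorem exists_latticePoint_of_mem_cube {m n : ℕ} (hn : 0 < n) {y : Space d}
    (hy : y ∈ cube (m * n) 0) :
    ∃ c ∈ Finset.Icc (fun _ : Fin d => -(m : ℤ)) (fun _ => (m : ℤ)),
      y ∈ cube n (latticePoint n c) := by
  have hn' : (0 : ℝ) < n := by exact_mod_cast hn
  refine ⟨fun i => round (y i / n), ?_, fun i => ?_⟩
  · have hbound (i : Fin d) : |round (y i / n)| < (m : ℤ) + 1 := by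
      have hyi : |y i / n| ≤ m / 2 := by
        rw [abs_div, abs_of_pos hn', div_le_iff₀ hn', ← sub_zero (y i)]
        exact (hy i).trans_eq (mul_div_right_comm _ _ _)
      have hround := abs_sub_round (y i / n)
      have hm : (0 : ℝ) ≤ m := m.cast_nonneg
      have : |(round (y i / n) : ℝ)| < (m : ℝ) + 1 := by
        rw [abs_le] at hyi hround
        rw [abs_lt]
        constructor <;> linarith
      exact_mod_cast this
    rw [Finset.mem_Icc]
    exact ⟨fun i => (abs_le.1 (Int.lt_add_one_iff.1 (hbound i))).1,
      fun i => (abs_le.1 (Int.lt_add_one_iff.1 (hbound i))).2⟩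
  · have hyi : y i - latticePoint n (fun i => round (y i / n)) i =
        n * (y i / n - round (y i / n)) := by
      rw [latticePoint, mul_sub, mul_div_cancel₀ _ hn'.ne']
    rw [hyi, abs_mul, abs_of_pos hn', div_eq_mul_one_div (n : ℝ)]
    exact mul_le_mul_of_nonneg_left (abs_sub_round _) hn'.le

theorem IsStabilizationField.measure_not_supRadius_mul_lt_le (hR : IsStabilizationField P Λ R)
    (m : ℕ) {n : ℕ} (hn : 0 < n) :
    P {ω | ¬supRadius R (m * n) 0 ω < n} ≤
      (Finset.Icc (fun _ : Fin d => -(m : ℤ)) (fun _ => (m : ℤ))).card *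
        P {ω | ¬supRadius R n 0 ω < n} := by
  set I := Finset.Icc (fun _ : Fin d => -(m : ℤ)) (fun _ => (m : ℤ))
  have hcover : {ω | ¬supRadius R (m * n) 0 ω < n} ⊆
      ⋃ c ∈ I, {ω | ¬supRadius R n (latticePoint n c) ω < n} := by
    intro ω hω
    by_contra hcon
    simp only [Set.mem_iUnion, Set.mem_ofPred_eq, not_exists, not_not] at hcon
    refine hω (lt_of_le_of_lt (iSup₂_le fun y hy => ?_)
      ((Finset.sup_lt_iff (f := fun c => supRadius R n (latticePoint n c) ω)
        (Nat.cast_pos.2 hn)).2 hcon))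
    obtain ⟨c, hc, hyc⟩ := exists_latticePoint_of_mem_cube hn hy.1
    exact (le_iSup₂ (f := fun y _ => R y ω) y ⟨hyc, hy.2⟩).trans
      (Finset.le_sup (f := fun c => supRadius R n (latticePoint n c) ω) hc)
  calc P {ω | ¬supRadius R (m * n) 0 ω < n}
      ≤ P (⋃ c ∈ I, {ω | ¬supRadius R n (latticePoint n c) ω < n}) := measure_mono hcover
    _ ≤ ∑ c ∈ I, P {ω | ¬supRadius R n (latticePoint n c) ω < n} :=
        measure_biUnion_finset_le _ _
    _ = I.card * P {ω | ¬supRadius R n 0 ω < n} := by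
        rw [Finset.sum_congr rfl fun c _ =>
          hR.measure_not_supRadius_lt n (latticePoint_mem_rationalPoints n c) n,
          Finset.sum_const, nsmul_eq_mul]

variable [IsProbabilityMeasure P]

theorem IsStabilizationField.tendsto_measure_not_supRadius_lt (hR : IsStabilizationField P Λ R) :
    Tendsto (fun n : ℕ => P {ω | ¬supRadius R n 0 ω < n}) atTop (𝓝 0) := by
  have hcompl (n : ℕ) : P {ω | ¬supRadius R n 0 ω < n} = 1 - P {ω | supRadius R n 0 ω < n} :=
    prob_compl_eq_one_sub (measurableSet_lt (measurable_supRadius hR.measurable _ _)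
      measurable_const)
  simp only [hcompl]
  simpa using ENNReal.Tendsto.sub tendsto_const_nhds hR.tendsto_one (.inl ENNReal.one_ne_top)

theorem IsStabilizationField.tendsto_measure_not_supRadius_mul_lt
    (hR : IsStabilizationField P Λ R) (m : ℕ) :
    Tendsto (fun n : ℕ => P {ω | ¬supRadius R (m * n) 0 ω < n}) atTop (𝓝 0) := by
  have hbound := ENNReal.Tendsto.const_mul hR.tendsto_measure_not_supRadius_lt
    (.inr (ENNReal.natCast_ne_top
      (Finset.Icc (fun _ : Fin d => -(m : ℤ)) (fun _ => (m : ℤ))).card))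
  rw [mul_zero] at hbound
  refine tendsto_of_tendsto_of_tendsto_of_le_of_le' tendsto_const_nhds hbound
    (Eventually.of_forall fun _ => zero_le) ?_
  filter_upwards [eventually_gt_atTop 0] with n hn
  exact hR.measure_not_supRadius_mul_lt_le m hn

end Stationarity

section Independence

variable {d : ℕ} {Ω : Type*} [MeasurableSpace Ω] {P : Measure Ω} {Λ : Ω → Measure (Space d)}
  {R : Space d → Ω → ℝ≥0∞} {ι : Type*} {n : ℕ} {c : ι → Space d}
  {F : ι → Measure (Space d) → ℝ≥0}

-- Stabilization concerns a single functional of the measure. It is applied to `∑ i, F i`, which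
-- agrees with `F i` on the measures restricted to the cube around `c i`.
theorem IsStabilizationField.iIndepFun_indicator [Finite ι] (hR : IsStabilizationField P Λ R)
    (hn : 1 ≤ n)
    (hc : Pairwise fun i j => 3 * (n : ℝ) < dist (c i) (c j)) (hF : ∀ i, Measurable (F i))
    (hF1 : ∀ i μ, F i μ ≤ 1)
    (hself : ∀ i (μ : Measure (Space d)), F i (μ.restrict (cube n (c i))) = F i μ)
    (hne : ∀ i j, i ≠ j → ∀ μ : Measure (Space d), F j (μ.restrict (cube n (c i))) = 0) :
    iIndepFun (fun i => {ω | supRadius R n (c i) ω < n}.indicator fun ω => F i (Λ ω)) P := by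
  classical
  cases nonempty_fintype ι
  have hinj : Function.Injective c := fun i j hij => by
    by_contra h
    exact (hc h).not_ge (by rw [hij, dist_self]; positivity)
  have hsum (i : ι) (μ : Measure (Space d)) :
      ∑ j, F j (μ.restrict (cube n (c i))) = F i μ := by
    rw [Finset.sum_eq_single i (fun j _ hji => hne i j hji.symm μ) (by simp), hself]
  have hindep := hR.indep n hn (fun μ => ∑ j, F j μ) (Finset.measurable_sum _ fun j _ => hF j)
    ⟨∑ _j : ι, 1, fun μ => Finset.sum_le_sum fun j _ => hF1 j μ⟩ (Finset.univ.image c)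
    (by
      simp only [Finset.mem_image, Finset.mem_univ, true_and, forall_exists_index,
        forall_apply_eq_imp_iff]
      exact fun i j hij => hc fun h => hij (congrArg c h.symm))
  have hprecomp := hindep.precomp
    (g := fun i => ⟨c i, Finset.mem_image_of_mem c (Finset.mem_univ i)⟩)
    fun i j hij => hinj (congrArg Subtype.val hij)
  simpa only [hsum] using hprecomp

theorem IsStabilizationField.lintegral_prod_one_sub_le [Fintype ι]
    (hR : IsStabilizationField P Λ R) (hΛ : Measurable Λ) (hn : 1 ≤ n)
    (hc : Pairwise fun i j => 3 * (n : ℝ) < dist (c i) (c j))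
    (hF : ∀ i, Measurable (F i)) (hF1 : ∀ i μ, F i μ ≤ 1)
    (hself : ∀ i (μ : Measure (Space d)), F i (μ.restrict (cube n (c i))) = F i μ)
    (hne : ∀ i j, i ≠ j → ∀ μ : Measure (Space d), F j (μ.restrict (cube n (c i))) = 0) :
    ∫⁻ ω, ∏ i, (1 - (F i (Λ ω) : ℝ≥0∞)) ∂P ≤
      ∏ i, (P {ω | ¬supRadius R n (c i) ω < n} + ∫⁻ ω, (1 - (F i (Λ ω) : ℝ≥0∞)) ∂P) := by
  let Y (i : ι) : Ω → ℝ≥0 := {ω | supRadius R n (c i) ω < n}.indicator fun ω => F i (Λ ω)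
  have hYmeas (i : ι) : Measurable (Y i) :=
    ((hF i).comp hΛ).indicator
      (measurableSet_lt (measurable_supRadius hR.measurable n (c i)) measurable_const)
  have hsub : Measurable fun t : ℝ≥0 => 1 - (t : ℝ≥0∞) :=
    measurable_coe_nnreal_ennreal.const_sub 1
  calc ∫⁻ ω, ∏ i, (1 - (F i (Λ ω) : ℝ≥0∞)) ∂P
      ≤ ∫⁻ ω, ∏ i, (1 - (Y i ω : ℝ≥0∞)) ∂P :=
        lintegral_mono fun ω => Finset.prod_le_prod' fun i _ =>
          tsub_le_tsub_left (ENNReal.coe_le_coe.2 (Set.indicator_le_self' (by simp) ω)) 1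
    _ = ∏ i, ∫⁻ ω, (1 - (Y i ω : ℝ≥0∞)) ∂P :=
        lintegral_prod_eq_prod_lintegral_of_indepFun Finset.univ _
          ((hR.iIndepFun_indicator hn hc hF hF1 hself hne).comp (fun _ t => 1 - (t : ℝ≥0∞))
            fun _ => hsub) fun i => hsub.comp (hYmeas i)
    _ ≤ ∏ i, (P {ω | ¬supRadius R n (c i) ω < n} + ∫⁻ ω, (1 - (F i (Λ ω) : ℝ≥0∞)) ∂P) := by
        refine Finset.prod_le_prod' fun i _ => ?_
        have hradius := hR.measurableSet_not_supRadius_lt n (c i) n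
        rw [← lintegral_indicator_one hradius,
          ← lintegral_add_left (measurable_one.indicator hradius)]
        refine lintegral_mono fun ω => ?_
        by_cases hω : supRadius R n (c i) ω < n
        · simp only [Y, Set.indicator_of_mem (s := {ω | supRadius R n (c i) ω < n}) hω]
          exact le_add_self
        · rw [Set.indicator_of_mem (s := {ω | ¬supRadius R n (c i) ω < n}) hω]
          exact tsub_le_self.trans le_self_add

end Independence

section Windows

variable {d q k b : ℕ}

theorem exists_le_abs_planar_sub (hd : 2 ≤ d) {m : ℤ} {z z' : ℤ × ℤ}
    (h : m ≤ |z.1 - z'.1| ∨ m ≤ |z.2 - z'.2|) : ∃ i, m ≤ |planar d z i - planar d z' i| := by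
  rcases h with h | h
  · exact ⟨⟨0, by omega⟩, by simpa [planar] using h⟩
  · exact ⟨⟨1, by omega⟩, by simpa [planar] using h⟩

theorem cellIndex_left_injective (b : ℕ) (z : ℤ × ℤ) :
    Function.Injective (cellIndex b z : (Fin d → ℤ) → Fin d → ℤ) :=
  fun _ _ h => funext fun i => add_right_cancel (congrFun h i)

theorem cellIndex_ne (hb : 0 < b) {z z' : ℤ × ℤ} {i : Fin d}
    (h : 25 ≤ |planar d z i - planar d z' i|) (v v' : Window d b) :
    cellIndex b z v.1 ≠ cellIndex b z' v'.1 := by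
  intro heq
  have hi : v.1 i + 3 * b * planar d z i = v'.1 i + 3 * b * planar d z' i := congrFun heq i
  have := abs_le.1 (mem_window.1 v.2 i)
  have := abs_le.1 (mem_window.1 v'.2 i)
  have : (0 : ℤ) < b := by exact_mod_cast hb
  rcases le_abs.1 h with h | h <;> nlinarith

theorem cellIndex_injective_of_isSeparated (hd : 2 ≤ d) (hb : 0 < b) {T : Finset (ℤ × ℤ)}
    (hT : IsSeparated 25 (T : Set (ℤ × ℤ))) :
    Function.Injective fun p : T × Window d b => cellIndex b p.1.1 p.2.1 := by
  rintro ⟨z, v⟩ ⟨z', v'⟩ heq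
  have hzz' : z = z' := by
    by_contra hne
    obtain ⟨i, hi⟩ := exists_le_abs_planar_sub hd (hT z.2 z'.2 fun h => hne (Subtype.ext h))
    exact cellIndex_ne hb hi v v' heq
  subst hzz'
  exact Prod.ext rfl (Subtype.ext (cellIndex_left_injective b z heq))

theorem cell_subset_cube_siteCenter (hq : 0 < q) (hk : 0 < k) (z : ℤ × ℤ)
    (v : Window d (q * k)) :
    cell q (cellIndex (q * k) z v.1) ⊆ cube (24 * k : ℕ) (siteCenter d k z) := by
  have hqk : (1 : ℝ) ≤ q * k := by exact_mod_cast Nat.mul_pos hq hk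
  refine cell_subset_cube hq (m := 11 * (q * k)) (fun i => ?_) (by push_cast; linarith)
  have hindex : (cellIndex (q * k) z v.1 i : ℝ) - q * siteCenter d k z i = v.1 i := by
    simp only [cellIndex, siteCenter, latticePoint]
    push_cast
    ring
  rw [hindex]
  exact_mod_cast mem_window.1 v.2 i

theorem le_abs_siteCenter_sub {m : ℤ} {z z' : ℤ × ℤ} {i : Fin d}
    (h : m ≤ |planar d z i - planar d z' i|) :
    3 * (k : ℝ) * m ≤ |siteCenter d k z i - siteCenter d k z' i| := by
  have hm : (m : ℝ) ≤ |(planar d z i : ℝ) - planar d z' i| := by exact_mod_cast h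
  simp only [siteCenter, latticePoint, ← mul_sub, abs_mul, Nat.abs_cast]
  push_cast
  gcongr

theorem disjoint_cube {s : ℝ} {x y : Space d} {i : Fin d} (h : s < |x i - y i|) :
    Disjoint (cube s x) (cube s y) := by
  refine Set.disjoint_left.2 fun p hpx hpy => h.not_ge ?_
  calc |x i - y i| ≤ |x i - p i| + |p i - y i| := abs_sub_le _ _ _
    _ ≤ s / 2 + s / 2 := add_le_add (abs_sub_comm (x i) (p i) ▸ hpx i) (hpy i)
    _ = s := add_halves s

theorem windowMass_restrict_self (hq : 0 < q) (hk : 0 < k) (z : ℤ × ℤ)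
    (μ : Measure (Space d)) :
    windowMass q (q * k) z (μ.restrict (cube (24 * k : ℕ) (siteCenter d k z))) =
      windowMass q (q * k) z μ :=
  funext fun v => Measure.restrict_eq_self μ (cell_subset_cube_siteCenter hq hk z v)

theorem windowMass_restrict_of_ne (hq : 0 < q) (hk : 0 < k) {z z' : ℤ × ℤ} {i : Fin d}
    (h : 25 ≤ |planar d z i - planar d z' i|) (μ : Measure (Space d)) :
    windowMass q (q * k) z' (μ.restrict (cube (24 * k : ℕ) (siteCenter d k z))) = 0 := by
  have hk' : (0 : ℝ) < k := by exact_mod_cast hk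
  have hcenter := le_abs_siteCenter_sub (k := k) h
  have hdisj : Disjoint (cube (24 * k : ℕ) (siteCenter d k z'))
      (cube (24 * k : ℕ) (siteCenter d k z)) := by
    refine (disjoint_cube (hcenter.trans_lt' ?_)).symm
    push_cast
    linarith
  ext v
  rw [windowMass, Measure.restrict_apply (measurableSet_cell _ _),
    (hdisj.mono_left (cell_subset_cube_siteCenter hq hk z' v)).inter_eq, measure_empty,
    Pi.zero_apply]

theorem lt_dist_siteCenter (hk : 0 < k) {z z' : ℤ × ℤ} {i : Fin d}
    (h : 25 ≤ |planar d z i - planar d z' i|) :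
    3 * ((24 * k : ℕ) : ℝ) < dist (siteCenter d k z) (siteCenter d k z') := by
  have hk' : (0 : ℝ) < k := by exact_mod_cast hk
  calc 3 * ((24 * k : ℕ) : ℝ) < 3 * (k : ℝ) * (25 : ℤ) := by push_cast; linarith
    _ ≤ |siteCenter d k z i - siteCenter d k z' i| := le_abs_siteCenter_sub h
    _ ≤ dist (siteCenter d k z) (siteCenter d k z') := by
        rw [dist_eq_norm]
        exact PiLp.norm_apply_le (siteCenter d k z - siteCenter d k z') i

end Windows

section Scales

variable {d q k : ℕ} {Ω : Type*} [MeasurableSpace Ω] {P : Measure Ω}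
  {Λ : Ω → Measure (Space d)} {R : Space d → Ω → ℝ≥0∞}

theorem IsStationaryRandomMeasure.lintegral_one_sub_goodProb_eq
    (hΛ : IsStationaryRandomMeasure P Λ) (q k : ℕ) (l : ℝ≥0) (z : ℤ × ℤ) :
    ∫⁻ ω, (1 - (goodProb l (windowMass q (q * k) z (Λ ω)) : ℝ≥0∞)) ∂P =
      ∫⁻ ω, (1 - (goodProb l (windowMass q (q * k) 0 (Λ ω)) : ℝ≥0∞)) ∂P := by
  have hmeas : Measurable fun μ : Measure (Space d) =>
      1 - (goodProb l (windowMass q (q * k) 0 μ) : ℝ≥0∞) :=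
    ((measurable_goodProb l).comp (measurable_windowMass q (q * k) 0)).coe_nnreal_ennreal.const_sub
      1
  have h := ((hΛ.stationary (siteCenter d k z)).comp hmeas).lintegral_eq
  simpa only [Function.comp_def, windowMass_shift_siteCenter] using h

theorem measure_forall_notMem_goodSites_le_pow (hd : 2 ≤ d) (hΛ : IsStationaryRandomMeasure P Λ)
    (hR : IsStabilizationField P Λ R) (hq : 0 < q) (hk : 0 < k) {l : ℝ≥0}
    {X : Ω → Measure (Space d)} (hX : IsCoxProcess P Λ l X) {T : Finset (ℤ × ℤ)}
    (hT : IsSeparated 25 (T : Set (ℤ × ℤ))) :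
    P {ω | ∀ z ∈ T, z ∉ goodSites q (q * k) (Λ ω) (X ω)} ≤
      (P {ω | ¬supRadius R (24 * k : ℕ) 0 ω < (24 * k : ℕ)} +
        ∫⁻ ω, (1 - (goodProb l (windowMass q (q * k) 0 (Λ ω)) : ℝ≥0∞)) ∂P) ^ T.card := by
  have hfar {z z' : T} (hne : z ≠ z') : ∃ i, 25 ≤ |planar d z i - planar d z' i| :=
    exists_le_abs_planar_sub hd (hT z.2 z'.2 fun h => hne (Subtype.ext h))
  have hprod := hR.lintegral_prod_one_sub_le hΛ.measurable (n := 24 * k) (by omega)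
    (c := fun z : T => siteCenter d k z)
    (fun _ _ hne => (hfar hne).elim fun _ hi => lt_dist_siteCenter hk hi)
    (F := fun z μ => goodProb l (windowMass q (q * k) z μ))
    (fun z => (measurable_goodProb l).comp (measurable_windowMass q (q * k) z))
    (fun _ _ => goodProb_le_one _ _) (fun z μ => by rw [windowMass_restrict_self hq hk])
    (fun _ _ hne μ => (hfar hne).elim fun _ hi => by
      rw [windowMass_restrict_of_ne hq hk hi, goodProb_zero])
  simp only [hΛ.lintegral_one_sub_goodProb_eq, siteCenter,
    hR.measure_not_supRadius_lt _ (latticePoint_mem_rationalPoints _ _), Finset.prod_const,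
    Finset.card_univ, Fintype.card_coe] at hprod
  exact (hX.measure_forall_notMem_goodSites_le hΛ.measurable hq
    (cellIndex_injective_of_isSeparated hd (Nat.mul_pos hq hk) hT)).trans hprod

theorem tendsto_lintegral_one_sub_goodProb [IsFiniteMeasure P]
    (hΛ : IsStationaryRandomMeasure P Λ) (hq : 0 < q) (b : ℕ) :
    Tendsto (fun l : ℕ => ∫⁻ ω, (1 - (goodProb l (windowMass q b 0 (Λ ω)) : ℝ≥0∞)) ∂P) atTop
      (𝓝 (P {ω | ¬GoodPattern (Function.support (windowMass q b 0 (Λ ω)))})) := by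
  have hmass : Measurable fun ω => windowMass q b 0 (Λ ω) :=
    (measurable_windowMass q b 0).comp hΛ.measurable
  set bad : Set Ω := {ω | ¬GoodPattern (Function.support (windowMass q b 0 (Λ ω)))}
  have hbad : MeasurableSet bad := hmass (measurableSet_support_mem {O | ¬GoodPattern O})
  rw [← lintegral_indicator_one hbad]
  refine tendsto_lintegral_of_dominated_convergence 1
    (fun l => ((measurable_goodProb l).comp hmass).coe_nnreal_ennreal.const_sub 1)
    (fun l => ae_of_all _ fun ω => tsub_le_self) (by simp) ?_
  filter_upwards [ae_all_iff.2 fun v : Window d b => hΛ.ae_cell_ne_top hq (cellIndex b 0 v.1)]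
    with ω hω
  by_cases hgood : GoodPattern (Function.support (windowMass q b 0 (Λ ω)))
  · rw [Set.indicator_of_notMem (s := bad) (not_not.2 hgood)]
    have hsub := ENNReal.Tendsto.sub (tendsto_const_nhds (x := (1 : ℝ≥0∞)))
      (ENNReal.tendsto_coe.2 (tendsto_goodProb hω hgood)) (.inl ENNReal.one_ne_top)
    rwa [ENNReal.coe_one, tsub_self] at hsub
  · rw [Set.indicator_of_mem (s := bad) hgood]
    have hzero (l : ℕ) : goodProb l (windowMass q b 0 (Λ ω)) = 0 := by
      simp only [goodProb, GoodWindow, hgood, false_and, Set.ofPred_false, measure_empty,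
        ENNReal.toNNReal_zero]
    simp only [hzero, ENNReal.coe_zero, tsub_zero, Pi.one_apply, tendsto_const_nhds]

end Scales

section Percolation

variable {d q : ℕ} {Ω : Type*} [MeasurableSpace Ω] {P : Measure Ω} [IsProbabilityMeasure P]
  {Λ : Ω → Measure (Space d)}

theorem IsAsymptoticallyEssentiallyConnected.exists_tendsto_measure_not_goodPattern
    (hΛ : IsAsymptoticallyEssentiallyConnected P Λ) (hq : 0 < q) :
    ∃ R : Space d → Ω → ℝ≥0∞, IsStabilizationField P Λ R ∧
      Tendsto (fun u : ℕ => P {ω | ¬GoodPattern (Function.support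
        (windowMass q (q * (2 * u)) 0 (Λ ω)))}) atTop (𝓝 0) := by
  obtain ⟨R, hR, hconn⟩ := hΛ
  refine ⟨R, hR, ?_⟩
  have hinner := hR.tendsto_measure_not_supRadius_mul_lt 4
  have houter := hinner.comp (tendsto_id.const_mul_atTop' (show 0 < 10 by norm_num))
  have hsum := hinner.add houter
  rw [add_zero] at hsum
  refine tendsto_of_tendsto_of_tendsto_of_le_of_le' tendsto_const_nhds hsum
    (Eventually.of_forall fun _ => zero_le) ?_
  filter_upwards [eventually_gt_atTop 0] with u hu
  refine (measure_mono_ae ?_).trans (measure_union_le _ _)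
  filter_upwards [hconn] with ω hω hbad
  by_contra hcon
  have hside (m : ℕ) : 2 * ((2 * m : ℕ) : ℝ) = (4 : ℕ) * m := by push_cast; ring
  have hhalf (m : ℕ) : ((2 * m : ℕ) : ℝ≥0∞) / 2 = m := by
    rw [Nat.cast_mul, Nat.cast_ofNat, mul_comm,
      ENNReal.mul_div_cancel_right two_ne_zero ENNReal.ofNat_ne_top]
  have hconnected (m : ℕ) (hm : 0 < m) (hlt : supRadius R ((4 : ℕ) * m) 0 ω < m) :=
    hω (2 * m) (by omega) (by rwa [hside, hhalf])
  have hne := (hconnected u hu (not_not.1 (not_or.1 hcon).1)).1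
  have hcomponent := (hconnected (10 * u) (by omega) (not_not.1 (not_or.1 hcon).2)).2
  have h10 : ((2 * (10 * u) : ℕ) : ℝ) = 10 * (2 * u : ℕ) := by push_cast; ring
  rw [h10, ← mul_assoc, show (2 : ℝ) * 10 = 20 by norm_num] at hcomponent
  exact hbad (goodPattern_of_support hq (by omega) hne hcomponent)

theorem exists_measure_forall_notMem_goodSites_le_pow (hd : 2 ≤ d)
    (hΛ : IsStationaryRandomMeasure P Λ) (hconn : IsAsymptoticallyEssentiallyConnected P Λ)
    (hq : 0 < q) {ε : ℝ≥0∞} (hε : 0 < ε) :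
    ∃ k : ℕ, 0 < k ∧ ∃ l : ℝ≥0, 0 < l ∧ ∀ X : Ω → Measure (Space d), IsCoxProcess P Λ l X →
      ∀ T : Finset (ℤ × ℤ), IsSeparated 25 (T : Set (ℤ × ℤ)) →
        P {ω | ∀ z ∈ T, z ∉ goodSites q (q * k) (Λ ω) (X ω)} ≤ ε ^ T.card := by
  obtain ⟨R, hR, hpattern⟩ := hconn.exists_tendsto_measure_not_goodPattern hq
  have hradius := hR.tendsto_measure_not_supRadius_lt.comp
    (tendsto_id.const_mul_atTop' (show 0 < 48 by norm_num))
  have hε2 : 0 < ε / 2 := ENNReal.half_pos hε.ne'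
  obtain ⟨u, ⟨hu, hpattern⟩, hradius⟩ := (((eventually_gt_atTop 0).and
    (hpattern.eventually_lt_const hε2)).and (hradius.eventually_lt_const hε2)).exists
  obtain ⟨l, hl, hgood⟩ := ((eventually_gt_atTop 0).and
    ((tendsto_lintegral_one_sub_goodProb hΛ hq (q * (2 * u))).eventually_lt_const hpattern)).exists
  refine ⟨2 * u, by omega, l, by exact_mod_cast hl, fun X hX T hT =>
    (measure_forall_notMem_goodSites_le_pow hd hΛ hR hq (by omega) hX hT).trans ?_⟩
  rw [show 24 * (2 * u) = 48 * u by ring]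
  exact pow_le_pow_left' ((add_le_add hradius.le hgood.le).trans_eq (ENNReal.add_halves ε)) _

theorem exists_measure_percolates_pos (hd : 2 ≤ d) (hΛ : IsStationaryRandomMeasure P Λ)
    (hconn : IsAsymptoticallyEssentiallyConnected P Λ) {r : ℝ} (hr : 0 < r) :
    ∃ l : ℝ≥0, 0 < l ∧ ∀ X : Ω → Measure (Space d), IsCoxProcess P Λ l X →
      0 < P {ω | Percolates r (X ω)} := by
  obtain ⟨q, hq⟩ := exists_nat_gt (4 * d / r)
  have hqr : 4 * d < r * q := (div_lt_iff₀' hr).1 hq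
  replace hq : 0 < q := Nat.cast_pos.1 (hq.trans_le' (by positivity : 0 ≤ 4 * d / r))
  have hε : (0 : ℝ≥0∞) < (1 / 10) ^ 25 ^ 2 := ENNReal.pow_pos (by simp) _
  have hp : (9 : ℝ≥0∞) * (1 / 10) < 1 := by
    rw [mul_one_div]
    exact ENNReal.div_lt_of_lt_mul (by norm_num)
  obtain ⟨k, hk, l, hl, hbound⟩ :=
    exists_measure_forall_notMem_goodSites_le_pow hd hΛ hconn hq hε
  refine ⟨l, hl, fun X hX => pos_iff_ne_zero.2 fun hzero => ?_⟩
  refine not_ae_not_sitePercolates (P := P) (p := 1 / 10)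
    (bad := fun z => {ω | z ∉ goodSites q (q * k) (Λ ω) (X ω)}) hp
    (measure_forall_mem_le_pow (N := 25) (by norm_num) (by norm_num) (hbound X hX)) ?_
  filter_upwards [hX.counting, measure_eq_zero_iff_ae_notMem.1 hzero] with ω hω hnot hsite
  exact hnot (percolates_of_sitePercolates hd hq (Nat.mul_pos hq hk) hr hqr hω
    (by simpa only [Set.mem_ofPred_eq, not_not, Set.ofPred_mem_eq] using hsite))

end Percolation

end CoxPercolation

end

theorem theorem2p2 {d : ℕ} (hd : 2 ≤ d) {Ω : Type*} [MeasurableSpace Ω]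
    (P : Measure Ω) [IsProbabilityMeasure P]
    (Λ : Ω → Measure (CoxPercolation.Space d))
    (hΛ : CoxPercolation.IsStationaryRandomMeasure P Λ)
    (hconn : CoxPercolation.IsAsymptoticallyEssentiallyConnected P Λ)
    (X : ℝ≥0 → Ω → Measure (CoxPercolation.Space d))
    (hX : ∀ l : ℝ≥0, 0 < l → CoxPercolation.IsCoxProcess P Λ l (X l))
    (r : ℝ) (hr : 0 < r) :
    CoxPercolation.criticalIntensity P X r < ∞ := by
  obtain ⟨l, hl, hpos⟩ :=
    CoxPercolation.exists_measure_percolates_pos hd hΛ hconn hr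
  exact (iInf₂_le l ⟨hl, hpos (X l) (hX l hl)⟩).trans_lt ENNReal.coe_lt_top
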